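/- Let $\mathbb{P}^2=(\mathbb{R}^3\setminus\{0\})/\!\sim$ be the real projective plane with the quotient topology, and let $\pi:S^2\to\mathbb{P}^2$ be the quotient map from the unit sphere (the projective sphere), which identifies antipodal points. Let $P=\{p_1,\dots,p_n\}\subset\mathbb{P}^2$ be a finite set that contains at least six points in general position, i.e. there is a subset $S\subseteq P$ with $|S|\ge 6$ such that no three distinct points of $S$ are collinear. (The remaining points of $P$ are arbitrary.) Then there exists a projective triangulation with vertex set $P$. That is, there exist an abstract simplicial complex $K$ whose vertex set is exactly $P$ and a homeomorphism $h$ from the geometric realization $|K|$ onto $\mathbb{P}^2$ such that 1. every simplex of $K$ is contained in a $2$-simplex of $K$ (so the maximal simplices are triangles, each bounded by a $3$-cycle); 2. for every simplex $\sigma$ of $K$, the image under $h$ of the closed simplex $|\sigma|$ is a geodesic simplex with vertex set $\sigma$: one can choose for each $p\in\sigma$ a unit vector $u_p$ with $\pi(u_p)=p$ such that the vectors $u_p$ $(p\in\sigma)$ are linearly independent and $h(|\sigma|)=\pi\bigl(\{x\in S^2 : x=\sum_{p\in\sigma}c_p u_p,\ c_p\ge 0\}\bigr)$. In particular $h$ maps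 each vertex $p$ to the point $p$, each edge $\{p,q\}$ onto the image of a great arc on the projective sphere joining a copy of $p$ to a copy of $q$, and each $2$-simplex onto a projective triangle bounded by three such arcs. -/

import Mathlib

open scoped LinearAlgebra.Projectivization

noncomputable section

namespace ProjTri

/-- Three-dimensional Euclidean space. -/
abbrev E3 : Type := EuclideanSpace ℝ (Fin 3)

/-- The real projective plane: nonzero vectors of three-space up to nonzero real scalars. -/
abbrev P2 : Type := ℙ ℝ E3

/-- The quotient topology on the real projective plane. -/
instance instTopologicalSpaceP2 : TopologicalSpace P2 :=
  TopologicalSpace.coinduced (Projectivization.mk' ℝ : {v : E3 // v ≠ 0} → P2) inferInstance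

/-- The projective sphere: the unit sphere, on which antipodal points represent the same point
of the projective plane. -/
abbrev S2 : Type := Metric.sphere (0 : E3) 1

/-- The antipodal quotient map from the projective sphere to the projective plane. -/
def proj (x : S2) : P2 := Projectivization.mk ℝ (x : E3) (ne_zero_of_mem_unit_sphere x)

/-- A set of points of the projective plane is in general position if no three distinct points
of it are collinear. -/
def InGeneralPosition (S : Finset P2) : Prop :=
  ∀ p ∈ S, ∀ q ∈ S, ∀ r ∈ S, p ≠ q → q ≠ r → p ≠ r →
    ¬ Projectivization.IsCollinear ({p, q, r} : Set P2)

section Realization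

variable {V : Type*} [Fintype V]

/-- The closed geometric simplex spanned by a set `s` of vertices, in barycentric coordinates. -/
def closedSimplex (s : Finset V) : Set (V → ℝ) :=
  {x | x ∈ stdSimplex ℝ V ∧ ∀ v, v ∉ s → x v = 0}

/-- The geometric realization of a finite simplicial complex: the union of its closed simplices,
as a subspace of the space of real functions on the vertex set. -/
def realization (K : AbstractSimplicialComplex V) : Set (V → ℝ) :=
  ⋃ s ∈ K.faces, closedSimplex s

end Realization

/-- The spherical simplex spanned by a finite family of points of the sphere: the points of the
sphere that are nonnegative linear combinations of the given points. For two linearly independent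
points this is the (minor) great arc that joins them, for three linearly independent points it
is a closed spherical triangle. -/
def sphericalSimplex {ι : Type*} [Fintype ι] (u : ι → S2) : Set S2 :=
  {x | ∃ c : ι → ℝ, (∀ i, 0 ≤ c i) ∧ (x : E3) = ∑ i, c i • (u i : E3)}

/-- `A` is a geodesic simplex of the projective plane with vertex set `s`: the image of the
nondegenerate spherical simplex spanned by some choice, for each point of `s`, of one of its two
copies on the projective sphere. If `s` has two points then `A` is one of the two arcs
into which they divide the projective line through them (a great arc on the projective sphere); if
`s` has three points then `A` is one of the four triangles into which the lines joining
them divide the plane. -/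
def IsGeodesicSimplex {P : Finset P2} (s : Finset P) (A : Set P2) : Prop :=
  ∃ u : s → S2, (∀ p : s, proj (u p) = ((p : P) : P2)) ∧
    LinearIndependent ℝ (fun p : s => (u p : E3)) ∧
    A = proj '' sphericalSimplex u

/-- A projective triangulation with vertex set `P`. -/
structure ProjectiveTriangulation (P : Finset P2) where
  /-- The underlying simplicial complex; its vertices are exactly the points of `P`. -/
  complex : AbstractSimplicialComplex P
  /-- Every simplex lies in a 2-simplex, so the maximal simplices are the faces bounded
  by 3-cycles. -/
  pure_two : ∀ s ∈ complex.faces, ∃ t ∈ complex.faces, s ⊆ t ∧ t.card = 3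
  /-- The union of the simplices is homeomorphic to the projective plane. -/
  homeo : realization complex ≃ₜ P2
  /-- The homeomorphism carries every simplex onto a geodesic simplex with the same vertices:
  every vertex `p` to the point `p` itself, every edge to a great arc between its two end points,
  every face to a triangle bounded by three such arcs. -/
  geodesic : ∀ s ∈ complex.faces,
    IsGeodesicSimplex s (homeo '' {x | (x : P → ℝ) ∈ closedSimplex s})

end ProjTri

end

/-!
A triangulation of the projective plane with vertex set `P` is the quotient, by the antipodal map,
of a centrally symmetric complete simplicial fan in three-space with rays `±v a`, where `v a` is a unit
vector representing `a ∈ P`. The fan has to be such that no triangle contains antipodal rays and two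
points are joined by only one edge in the quotient (`IsProjFan`). A complete fan is encoded
by the property that every vector has exactly one expansion with nonnegative coefficients
supported on one of its simplices (`IsFan`). Such expansions are barycentric coordinates, so they
give a continuous bijection from the realization of the quotient complex onto the projective plane,
which is a homeomorphism by compactness (`IsProjFan.homeo`).

Fans are modified by bistellar flips: moving coefficients along the linear relation that defines the
flip turns the unique expansions for the old fan into those for the new one (`IsFan.bistellar`).
Stellar subdivisions and flips of diagonals of convex quadrilaterals are special cases. An
antipodal pair of stellar subdivisions adds an arbitrary further point to a projective fan
(`IsProjFan.insert`), so it is enough to treat six points in general position.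

Any five of these, suitably ordered and with suitable signs, are the vertices of a convex pentagon
(`hasProjFan_of_pos`). The pentagon is cut into three triangles, and the Möbius band outside of it
into five triangles, each with one side of the pentagon and the opposite vertex. This fan is
obtained from the eight octants of a basis by two stellar subdivisions and one flip, all up to
antipodes (`isFan_pentagonFan`). Two diagonals of the pentagon are edges both inside and outside.
The sixth point lies in the interior of one of the eight triangles. Up to rotation of the pentagon
it lies in a triangle of the Möbius band, in a triangle cut off by a diagonal, or in the middle
triangle of the pentagon. In each case the triangle is subdivided, and two or three flips, whose
quadrilaterals are convex for any position of the point in that triangle, remove the double edges.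
-/

namespace ProjTri

/-! ### Complete simplicial fans and bistellar flips -/

section Fan

variable {ι : Type*}

/-- Nonnegative coefficients that are supported on a member of `T`. -/
def IsCoord (T : Finset (Finset ι)) (c : ι → ℝ) : Prop :=
  (∀ i, 0 ≤ c i) ∧ ∃ t ∈ T, ∀ i, i ∉ t → c i = 0

/-- The cones spanned by the families `u i`, `i ∈ t`, for `t ∈ T` are the maximal cones of a
complete simplicial fan: every vector has exactly one expansion with nonnegative coefficients supported on a
member of `T`. Uniqueness encodes both that every cone is simplicial and that two cones meet in
the cone over their common generators. -/
structure IsFan [Fintype ι] (u : ι → E3) (T : Finset (Finset ι)) : Prop where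
  exists_coord : ∀ x : E3, ∃ c, IsCoord T c ∧ ∑ i, c i • u i = x
  unique : ∀ c d, IsCoord T c → IsCoord T d → ∑ i, c i • u i = ∑ i, d i • u i → c = d

/-- Moving nonnegative coefficients against `g` until the first one in `A` vanishes. -/
lemma exists_sub_smul_nonneg {c g : ι → ℝ} {A : Finset ι} (hc : ∀ i, 0 ≤ c i) (hA : A.Nonempty)
    (hgA : ∀ a ∈ A, 0 < g a) (hg : ∀ i, i ∉ A → g i ≤ 0) :
    ∃ μ : ℝ, 0 ≤ μ ∧ (∀ i, 0 ≤ c i - μ * g i) ∧ ∃ a ∈ A, c a - μ * g a = 0 := by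
  obtain ⟨a, ha, hmin⟩ := A.exists_min_image (fun i => c i / g i) hA
  have hμ : 0 ≤ c a / g a := div_nonneg (hc a) (hgA a ha).le
  refine ⟨c a / g a, hμ, fun i => ?_, a, ha, ?_⟩
  · by_cases hi : i ∈ A
    · have := (le_div_iff₀ (hgA i hi)).1 (hmin i hi)
      linarith
    · nlinarith [hc i, hg i hi]
  · have := (hgA a ha).ne'
    field_simp
    ring

variable [DecidableEq ι]

/-- A bistellar flip preserves complete simplicial fans. The linear relation `g`, positive on `A`
and negative on `B`, describes the flip, and `L` is the common link. Moving coefficients along `g`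
turns expansions over the old cones into expansions over the new ones and back. A flip with `A` a
single new ray is a stellar subdivision. -/
theorem IsFan.bistellar [Fintype ι] {u : ι → E3} {T T' : Finset (Finset ι)} (hT : IsFan u T)
    {A B : Finset ι} {L : Finset (Finset ι)} {g : ι → ℝ} (hA : A.Nonempty) (hB : B.Nonempty)
    (hgA : ∀ a ∈ A, 0 < g a) (hgB : ∀ b ∈ B, g b < 0) (hg0 : ∀ i, i ∉ A → i ∉ B → g i = 0)
    (hg : ∑ i, g i • u i = 0) (hL : ∀ l ∈ L, Disjoint l (A ∪ B))
    (h1 : ∀ t ∈ T, B ⊆ t → ∃ l ∈ L, ∃ a ∈ A, t = (A ∪ B).erase a ∪ l)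
    (h2 : ∀ l ∈ L, ∀ a ∈ A, (A ∪ B).erase a ∪ l ∈ T)
    (h3 : ∀ t, t ∈ T' ↔ (t ∈ T ∧ ¬ B ⊆ t) ∨ ∃ l ∈ L, ∃ b ∈ B, t = (A ∪ B).erase b ∪ l) :
    IsFan u T' := by
  have hsum : ∀ (c : ι → ℝ) (μ : ℝ), ∑ i, (c i - μ * g i) • u i = ∑ i, c i • u i := by
    intro c μ
    simp only [sub_smul, mul_smul, Finset.sum_sub_distrib, ← Finset.smul_sum, hg, smul_zero,
      sub_zero]
  have hgA' : ∀ i, i ∉ A → g i ≤ 0 := fun i hi => by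
    by_cases hb : i ∈ B
    · exact (hgB i hb).le
    · exact (hg0 i hi hb).le
  have hgB' : ∀ i, i ∉ B → -g i ≤ 0 := fun i hi => by
    by_cases hb : i ∈ A
    · linarith [hgA i hb]
    · rw [hg0 i hb hi]; simp
  have hdown : ∀ c, IsCoord T' c →
      ∃ μ : ℝ, IsCoord T (fun i => c i - μ * g i) ∧ ∃ b ∈ B, c b = 0 := by
    rintro c ⟨hc, t, ht, hct⟩
    rcases (h3 t).1 ht with ⟨htT, hBt⟩ | ⟨l, hl, b, hb, rfl⟩
    · obtain ⟨b, hb, hbt⟩ := Finset.not_subset.1 hBt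
      exact ⟨0, ⟨by simpa using hc, t, htT, by simpa using hct⟩, b, hb, hct b hbt⟩
    · obtain ⟨μ, -, hnn, a, ha, h0⟩ := exists_sub_smul_nonneg hc hA hgA hgA'
      refine ⟨μ, ⟨hnn, _, h2 l hl a ha, fun i hi => ?_⟩, b, hb, hct b ?_⟩
      · by_cases hia : i = a
        · rw [hia]; exact h0
        · simp only [Finset.mem_union, Finset.mem_erase, not_or, not_and] at hi
          have := hi.1 hia
          beta_reduce
          rw [hg0 i this.1 this.2, hct i] <;> simp_all
      · have := Finset.disjoint_right.1 (hL l hl) (Finset.mem_union_right A hb)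
        simp [this]
  constructor
  · intro x
    obtain ⟨c, ⟨hc, t, ht, hct⟩, hx⟩ := hT.exists_coord x
    by_cases hBt : B ⊆ t
    · obtain ⟨l, hl, a, ha, rfl⟩ := h1 t ht hBt
      obtain ⟨μ, -, hnn, b, hb, h0⟩ := exists_sub_smul_nonneg (g := fun i => -g i) hc hB
        (fun b hb => neg_pos.2 (hgB b hb)) hgB'
      refine ⟨fun i => c i - (-μ) * g i, ⟨fun i => by simpa using hnn i, _,
        (h3 _).2 (Or.inr ⟨l, hl, b, hb, rfl⟩), fun i hi => ?_⟩, by rw [hsum, hx]⟩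
      by_cases hib : i = b
      · rw [hib]; simpa using h0
      · simp only [Finset.mem_union, Finset.mem_erase, not_or, not_and] at hi
        have := hi.1 hib
        beta_reduce
        rw [hg0 i this.1 this.2, hct i] <;> simp_all
    · exact ⟨c, ⟨hc, t, (h3 t).2 (Or.inl ⟨ht, hBt⟩), hct⟩, hx⟩
  · intro c d hc hd hcd
    obtain ⟨μ, hμ, b, hb, hcb⟩ := hdown c hc
    obtain ⟨ν, hν, b', hb', hdb⟩ := hdown d hd
    have key := hT.unique _ _ hμ hν (by rw [hsum, hsum, hcd])
    have key' : ∀ i, c i - μ * g i = d i - ν * g i := fun i => congrFun key i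
    -- Both expansions vanish somewhere on `B`, which forces the same shift along `g`.
    have hμν : μ = ν := by
      rcases lt_trichotomy μ ν with h | h | h
      · have := key' b
        nlinarith [hd.1 b, hgB b hb]
      · exact h
      · have := key' b'
        nlinarith [hc.1 b', hgB b' hb']
    funext i
    have := key' i
    rw [hμν] at this
    linarith

/-- The stellar subdivision at the new ray `w`: every simplex that contains `σ` is replaced by the
cones from `w` over its facets opposite to the vertices of `σ`. -/
def stellar (T : Finset (Finset ι)) (σ : Finset ι) (w : ι) : Finset (Finset ι) :=
  T.filter (fun t => ¬ σ ⊆ t) ∪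
    (T.filter (fun t => σ ⊆ t)).biUnion fun t => σ.image fun b => insert w (t.erase b)

lemma mem_stellar {T : Finset (Finset ι)} {σ : Finset ι} {w : ι} {t : Finset ι} :
    t ∈ stellar T σ w ↔
      (t ∈ T ∧ ¬ σ ⊆ t) ∨ ∃ s ∈ T, σ ⊆ s ∧ ∃ b ∈ σ, t = insert w (s.erase b) := by
  simp only [stellar, Finset.mem_union, Finset.mem_filter, Finset.mem_biUnion, Finset.mem_image]
  grind

theorem IsFan.stellar [Fintype ι] {u : ι → E3} {T : Finset (Finset ι)} (hT : IsFan u T)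
    {σ : Finset ι} {w : ι}
    (hw : ∀ t ∈ T, w ∉ t) (hwσ : w ∉ σ) (hσ : σ.Nonempty) {c : ι → ℝ} (hc : ∀ i ∈ σ, 0 < c i)
    (huw : u w = ∑ i ∈ σ, c i • u i) : IsFan u (stellar T σ w) := by
  refine hT.bistellar (A := {w}) (B := σ) (L := (T.filter (fun t => σ ⊆ t)).image (· \ σ))
    (g := fun i => if i = w then 1 else if i ∈ σ then -c i else 0) (by simp) hσ (by simp)
    ?_ ?_ ?_ ?_ ?_ ?_ ?_
  · intro b hb
    have : b ≠ w := fun h => hwσ (h ▸ hb)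
    simp [this, hb, hc b hb]
  · intro i hi hi'
    simp_all
  · have : ∀ i, (if i = w then (1 : ℝ) else if i ∈ σ then -c i else 0) • u i =
        (if i = w then u w else 0) - if i ∈ σ then c i • u i else 0 := by
      intro i
      by_cases h : i = w
      · subst h; simp [hwσ]
      · by_cases h' : i ∈ σ <;> simp [h, h']
    rw [Finset.sum_congr rfl fun i _ => this i, Finset.sum_sub_distrib]
    simp [huw]
  · simp only [Finset.mem_image, Finset.mem_filter]
    rintro _ ⟨t, ⟨ht, -⟩, rfl⟩
    rw [Finset.disjoint_left]
    have := hw t ht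
    grind
  · intro t ht hσt
    refine ⟨t \ σ, Finset.mem_image_of_mem _ (by simp [ht, hσt]), w, by simp, ?_⟩
    have := hw t ht
    grind
  · simp only [Finset.mem_image, Finset.mem_filter, Finset.mem_singleton]
    rintro _ ⟨t, ⟨ht, hσt⟩, rfl⟩ a rfl
    convert ht using 1
    grind
  · intro t
    rw [mem_stellar]
    refine or_congr Iff.rfl ?_
    simp only [Finset.mem_image, Finset.mem_filter]
    constructor
    · rintro ⟨s, hs, hσs, b, hb, rfl⟩
      refine ⟨_, ⟨s, ⟨hs, hσs⟩, rfl⟩, b, hb, ?_⟩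
      have := hw s hs
      grind
    · rintro ⟨_, ⟨s, ⟨hs, hσs⟩, rfl⟩, b, hb, rfl⟩
      refine ⟨s, hs, hσs, b, hb, ?_⟩
      have := hw s hs
      grind

/-- The flip of the diagonal `a c` of a quadrilateral `a b c d` to the other diagonal `b d`. -/
def flip (T : Finset (Finset ι)) (a c b d : ι) : Finset (Finset ι) :=
  T.filter (fun t => ¬ {a, c} ⊆ t) ∪ {{a, b, d}, {c, b, d}}

/-- The relation `α a + γ c = β b + δ d` with positive coefficients says that the quadrilateral
`a b c d` is convex. -/
theorem IsFan.flip [Fintype ι] {u : ι → E3} {T : Finset (Finset ι)} (hT : IsFan u T) (a c b d : ι)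
    (hne : [a, c, b, d].Nodup) (h1 : ∀ t ∈ T, {a, c} ⊆ t → t = {a, c, b} ∨ t = {a, c, d})
    (h2 : {a, c, b} ∈ T ∧ {a, c, d} ∈ T)
    (hrel : ∃ α γ β δ : ℝ, 0 < α ∧ 0 < γ ∧ 0 < β ∧ 0 < δ ∧
      α • u a + γ • u c = β • u b + δ • u d) : IsFan u (flip T a c b d) := by
  obtain ⟨α, γ, β, δ, hα, hγ, hβ, hδ, hrel⟩ := hrel
  simp only [List.nodup_cons, List.mem_cons, List.not_mem_nil, or_false, not_or,
    List.nodup_nil, not_false_eq_true, and_true] at hne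
  obtain ⟨⟨hac, hab, had⟩, ⟨hcb, hcd⟩, hbd⟩ := hne
  refine hT.bistellar (A := {b, d}) (B := {a, c}) (L := {∅})
    (g := fun i => (if i = b then β else 0) + (if i = d then δ else 0) - (if i = a then α else 0)
      - (if i = c then γ else 0)) (by simp) (by simp) ?_ ?_ ?_ ?_ (by simp) ?_ ?_ ?_
  · simp [hbd, Ne.symm hab, Ne.symm had, Ne.symm hcb, Ne.symm hcd, Ne.symm hbd, hβ, hδ]
  · simp [hac, hab, had, hcb, hcd, Ne.symm hac, hα, hγ]
  · intro i hi hi'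
    simp_all
  · simp only [sub_smul, add_smul, Finset.sum_sub_distrib, Finset.sum_add_distrib, ite_smul,
      zero_smul, Finset.sum_ite_eq', Finset.mem_univ, if_true, ← hrel]
    abel
  · intro t ht hBt
    rcases h1 t ht hBt with rfl | rfl
    · exact ⟨∅, by simp, d, by simp, by grind⟩
    · exact ⟨∅, by simp, b, by simp, by grind⟩
  · intro l hl x hx
    obtain rfl := Finset.mem_singleton.1 hl
    rcases Finset.mem_insert.1 hx with rfl | hx
    · convert h2.2 using 1; grind
    · obtain rfl := Finset.mem_singleton.1 hx
      convert h2.1 using 1; grind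
  · intro t
    simp only [ProjTri.flip, Finset.mem_union, Finset.mem_filter, Finset.mem_insert,
      Finset.mem_singleton, exists_eq_left, exists_eq_or_imp, Finset.union_empty]
    have e1 : (({b, d} : Finset ι) ∪ {a, c}).erase a = {c, b, d} := by grind
    have e2 : (({b, d} : Finset ι) ∪ {a, c}).erase c = {a, b, d} := by grind
    rw [e1, e2]
    tauto

end Fan

/-! ### Centrally symmetric fans -/

section Symmetric

variable {α β : Type*}

/-- The label of the antipodal vector. A pair `(a, b) : α × Bool` labels the vector `v a` if `b` is
true and `-v a` if `b` is false. -/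
def opp (i : α × Bool) : α × Bool := (i.1, !i.2)

/-- The vectors `v a` and `-v a`. -/
def signed (v : α → E3) (i : α × Bool) : E3 := if i.2 then v i.1 else -v i.1

@[simp] lemma opp_opp (i : α × Bool) : opp (opp i) = i := by simp [opp]

@[simp] lemma opp_fst (i : α × Bool) : (opp i).1 = i.1 := rfl

lemma opp_injective : Function.Injective (opp : α × Bool → α × Bool) :=
  Function.LeftInverse.injective opp_opp

lemma eq_or_eq_opp {i j : α × Bool} (h : i.1 = j.1) : i = j ∨ i = opp j := by
  rcases i with ⟨a, _ | _⟩ <;> rcases j with ⟨b, _ | _⟩ <;> simp_all [opp]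

@[simp] lemma signed_opp (v : α → E3) (i : α × Bool) : signed v (opp i) = -signed v i := by
  rcases i with ⟨a, _ | _⟩ <;> simp [opp, signed]

/-- A centrally symmetric complete simplicial fan with rays in the directions `±v a`, `a ∈ Q`, whose
quotient by the antipodal map is a simplicial complex: a pair of points of `Q` is joined by
at most one edge of the quotient, and no edge joins antipodal rays. -/
structure IsProjFan [Fintype α] [DecidableEq α] (v : α → E3) (Q : Finset α)
    (T : Finset (Finset (α × Bool))) : Prop where
  fan : IsFan (signed v) T
  symm : ∀ t ∈ T, t.image opp ∈ T
  card : ∀ t ∈ T, t.card = 3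
  simple : ∀ s ∈ T, ∀ t ∈ T, ∀ i ∈ s, i ∈ t → ∀ j ∈ s, opp j ∉ t
  mem : ∀ t ∈ T, ∀ i ∈ t, i.1 ∈ Q
  cover : ∀ a ∈ Q, ∃ t ∈ T, (a, true) ∈ t

lemma mem_image_opp [DecidableEq α] {t : Finset (α × Bool)} {i : α × Bool} :
    i ∈ t.image opp ↔ opp i ∈ t := by
  rw [Finset.mem_image]
  exact ⟨by rintro ⟨j, hj, rfl⟩; simpa using hj, fun h => ⟨_, h, opp_opp i⟩⟩

lemma image_opp_image_opp [DecidableEq α] (t : Finset (α × Bool)) :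
    (t.image opp).image opp = t := by
  ext i; rw [mem_image_opp, mem_image_opp, opp_opp]

/-- A new point is added to a projective fan by a pair of antipodal stellar subdivisions, at the
minimal cone that contains the point and at its antipode. -/
theorem IsProjFan.insert [Fintype α] [DecidableEq α] {v : α → E3} {Q : Finset α}
    {T : Finset (Finset (α × Bool))} (h : IsProjFan v Q T) {w : α} (hw : w ∉ Q) (h0 : v w ≠ 0)
    (hne : ∀ a ∈ Q, ∀ r : ℝ, v w ≠ r • v a) :
    ∃ T', IsProjFan v (insert w Q) T' := by
  obtain ⟨c, ⟨hc, t₀, ht₀, hct₀⟩, hcw⟩ := h.fan.exists_coord (v w)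
  -- The minimal cone that contains `v w` is spanned by the support of the coefficients.
  set σ : Finset (α × Bool) := Finset.univ.filter fun i => c i ≠ 0 with hσdef
  have hσ0 : σ ⊆ t₀ := fun i hi => by
    by_contra hit
    simp [hσdef, hct₀ i hit] at hi
  have hcσ : ∀ i ∈ σ, 0 < c i := fun i hi =>
    lt_of_le_of_ne (hc i) (Ne.symm (by simpa [hσdef] using hi))
  have hsumσ : v w = ∑ i ∈ σ, c i • signed v i := by
    rw [← hcw, hσdef, Finset.sum_filter]
    refine Finset.sum_congr rfl fun i _ => ?_
    by_cases hi : c i = 0 <;> simp [hi]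
  have hσne : σ.Nonempty := by
    rw [Finset.nonempty_iff_ne_empty]
    intro he
    rw [he] at hsumσ
    exact h0 (by simpa using hsumσ)
  -- The point `w` is not one of the old points, so that no old vertex disappears.
  have hσ1 : ∀ i, ∃ b ∈ σ, b ≠ i := by
    intro i
    by_contra! hcon
    have hσi : σ = {i} := Finset.eq_singleton_iff_nonempty_unique_mem.2 ⟨hσne, hcon⟩
    rw [hσi, Finset.sum_singleton] at hsumσ
    have hiQ := h.mem t₀ ht₀ i (hσ0 (by simp [hσi]))
    rcases i with ⟨a, _ | _⟩
    · exact hne a hiQ (-c (a, false)) (by simpa [signed] using hsumσ)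
    · exact hne a hiQ (c (a, true)) (by simpa [signed] using hsumσ)
  have hwT : ∀ t ∈ T, ∀ b, (w, b) ∉ t := fun t ht b hb => hw (h.mem t ht _ hb)
  have hconf : ∀ t ∈ T, σ ⊆ t → ¬ σ.image opp ⊆ t := by
    intro t ht h1 h2
    obtain ⟨i, hi⟩ := hσne
    exact h.simple t ht t ht i (h1 hi) (h1 hi) i (h1 hi) (h2 (Finset.mem_image_of_mem _ hi))
  set τ : Bool → Finset (α × Bool) := fun b => if b then σ else σ.image opp with hτ
  set T' := stellar (stellar T σ (w, true)) (σ.image opp) (w, false) with hT'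
  have hmem : ∀ t, t ∈ T' ↔ (t ∈ T ∧ ∀ b, ¬ τ b ⊆ t) ∨
      ∃ b, ∃ s ∈ T, τ b ⊆ s ∧ ∃ k ∈ τ b, t = Insert.insert (w, b) (s.erase k) := by
    have hwσ' : (w, true) ∉ σ.image opp := fun hh =>
      hwT t₀ ht₀ false (hσ0 (by simpa [mem_image_opp, opp] using hh))
    have hno : ∀ s ∈ T, σ ⊆ s → ∀ k, ¬ σ.image opp ⊆ Insert.insert (w, true) (s.erase k) := by
      intro s hs hσs k hsub
      refine hconf s hs hσs fun i hi => ?_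
      have := hsub hi
      rcases Finset.mem_insert.1 this with rfl | hi'
      · exact absurd hi hwσ'
      · exact Finset.mem_of_mem_erase hi'
    intro t
    simp only [hT', mem_stellar, Bool.forall_bool, Bool.exists_bool, hτ, if_true,
      Bool.false_eq_true, if_false]
    constructor
    · rintro (⟨⟨h1, h2⟩ | ⟨s, hs, hσs, k, hk, rfl⟩, h3⟩ | ⟨s, ⟨hs, h1⟩ | ⟨r, hr, hσr, k', hk', rfl⟩,
        hσs, k, hk, rfl⟩)
      · exact Or.inl ⟨h1, h3, h2⟩
      · exact Or.inr (Or.inr ⟨s, hs, hσs, k, hk, rfl⟩)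
      · exact Or.inr (Or.inl ⟨s, hs, hσs, k, hk, rfl⟩)
      · exact absurd hσs (hno r hr hσr k')
    · rintro (⟨h1, h3, h2⟩ | ⟨s, hs, hσs, k, hk, rfl⟩ | ⟨s, hs, hσs, k, hk, rfl⟩)
      · exact Or.inl ⟨Or.inl ⟨h1, h2⟩, h3⟩
      · exact Or.inr ⟨s, Or.inl ⟨hs, fun hh => hconf s hs hh hσs⟩, hσs, k, hk, rfl⟩
      · exact Or.inl ⟨Or.inr ⟨s, hs, hσs, k, hk, rfl⟩, hno s hs hσs k⟩
  have hττ : ∀ b, (τ b).image opp = τ !b := by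
    rintro (_ | _) <;> simp [hτ, image_opp_image_opp]
  have hτne : ∀ b, (τ b).Nonempty := by
    rintro (_ | _) <;> simp [hτ, hσne]
  have hτ1 : ∀ b i, ∃ k ∈ τ b, k ≠ i := by
    rintro (_ | _) i
    · obtain ⟨k, hk, hki⟩ := hσ1 (opp i)
      exact ⟨opp k,
        by simpa only [hτ, Bool.false_eq_true, if_false, mem_image_opp, opp_opp] using hk,
        fun hh => hki (by rw [← hh, opp_opp])⟩
    · simpa [hτ] using hσ1 i
  have hfan1 : IsFan (signed v) (stellar T σ (w, true)) :=
    h.fan.stellar (fun t ht => hwT t ht true) (fun hh => hwT t₀ ht₀ true (hσ0 hh)) hσne hcσ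
      (by simpa [signed] using hsumσ)
  refine ⟨T', ?_, ?_, ?_, ?_, ?_, ?_⟩
  · refine hfan1.stellar (c := fun i => c (opp i)) ?_ ?_ (by simp [hσne]) ?_ ?_
    · intro t ht hwt
      rcases mem_stellar.1 ht with ⟨ht, -⟩ | ⟨s, hs, -, k, -, rfl⟩
      · exact hwT t ht false hwt
      · have := hwT s hs false
        simp_all
    · intro hh
      exact hwT t₀ ht₀ true (hσ0 (by simpa [mem_image_opp, opp] using hh))
    · intro i hi
      exact hcσ _ (mem_image_opp.1 hi)
    · rw [Finset.sum_image opp_injective.injOn]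
      simp only [opp_opp, signed_opp, smul_neg, Finset.sum_neg_distrib, ← hsumσ]
      simp [signed]
  · intro t ht
    rw [hmem] at ht ⊢
    rcases ht with ⟨ht, hb⟩ | ⟨b, s, hs, hσs, k, hk, rfl⟩
    · refine Or.inl ⟨h.symm t ht, fun b hsub => hb (!b) ?_⟩
      rw [← hττ, ← image_opp_image_opp t]
      exact Finset.image_subset_image hsub
    · refine Or.inr ⟨!b, _, h.symm s hs, ?_, opp k, ?_, ?_⟩
      · rw [← hττ]; exact Finset.image_subset_image hσs
      · rw [← hττ]; exact Finset.mem_image_of_mem _ hk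
      · rw [Finset.image_insert, Finset.image_erase opp_injective]
        rfl
  · intro t ht
    rcases (hmem t).1 ht with ⟨ht, hb⟩ | ⟨b, s, hs, hσs, k, hk, rfl⟩
    · exact h.card t ht
    · rw [Finset.card_insert_of_notMem fun hh => hwT s hs b (Finset.mem_of_mem_erase hh),
        Finset.card_erase_of_mem (hσs hk), h.card s hs]
  · -- Every new simplex lies in the join of a copy of `w` with an old simplex.
    have hpar : ∀ t ∈ T', ∃ r ∈ T, (∀ i ∈ t, i.1 ≠ w → i ∈ r) ∧ ∀ b, (w, b) ∈ t → τ b ⊆ r := by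
      intro t ht
      rcases (hmem t).1 ht with ⟨ht, -⟩ | ⟨b, s, hs, hσs, k, hk, rfl⟩
      · exact ⟨t, ht, fun i hi _ => hi, fun b hb => absurd hb (hwT t ht b)⟩
      · refine ⟨s, hs, fun i hi hiw => ?_, fun b' hb' => ?_⟩
        · rcases Finset.mem_insert.1 hi with rfl | hi
          · exact absurd rfl hiw
          · exact Finset.mem_of_mem_erase hi
        · rcases Finset.mem_insert.1 hb' with hb' | hb'
          · obtain rfl : b' = b := by simpa using hb'
            exact hσs
          · exact absurd (Finset.mem_of_mem_erase hb') (hwT s hs b')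
    have hopp : ∀ b, ∀ k ∈ τ b, opp k ∈ τ !b := fun b k hk =>
      hττ b ▸ Finset.mem_image_of_mem _ hk
    intro s hs t ht i his hit j hjs hjt
    obtain ⟨r, hr, hr1, hr2⟩ := hpar s hs
    obtain ⟨q, hq, hq1, hq2⟩ := hpar t ht
    have hboth : ∀ p ∈ T, ∀ b, τ b ⊆ p → ¬ τ (!b) ⊆ p := by
      intro p hp b h1 h2
      obtain ⟨k, hk⟩ := hτne b
      exact h.simple p hp p hp k (h1 hk) (h1 hk) k (h1 hk) (h2 (hopp b k hk))
    by_cases hiw : i.1 = w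
    · obtain ⟨i, b⟩ := i
      obtain rfl : i = w := hiw
      obtain ⟨k, hk⟩ := hτne b
      by_cases hjw : j.1 = i
      · obtain ⟨j, b'⟩ := j
        obtain rfl : j = i := hjw
        by_cases hbb : b' = b
        · subst hbb
          exact hboth q hq _ (hq2 _ hit) (hq2 _ hjt)
        · obtain rfl : b' = !b := by revert hbb; cases b <;> cases b' <;> simp
          exact hboth r hr _ (hr2 _ his) (hr2 _ hjs)
      · exact h.simple r hr q hq k (hr2 _ his hk) (hq2 _ hit hk) j (hr1 _ hjs hjw)
          (hq1 _ hjt hjw)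
    · by_cases hjw : j.1 = w
      · obtain ⟨j, b⟩ := j
        obtain rfl : j = w := hjw
        obtain ⟨k, hk⟩ := hτne b
        exact h.simple r hr q hq i (hr1 _ his hiw) (hq1 _ hit hiw) k (hr2 _ hjs hk)
          (hq2 _ hjt (hopp b k hk))
      · exact h.simple r hr q hq i (hr1 _ his hiw) (hq1 _ hit hiw) j (hr1 _ hjs hjw)
          (hq1 _ hjt hjw)
  · intro t ht i hi
    rcases (hmem t).1 ht with ⟨ht, hb⟩ | ⟨b, s, hs, hσs, k, hk, rfl⟩
    · exact Finset.mem_insert_of_mem (h.mem t ht i hi)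
    · rcases Finset.mem_insert.1 hi with rfl | hi
      · simp
      · exact Finset.mem_insert_of_mem (h.mem s hs i (Finset.mem_of_mem_erase hi))
  · intro a ha
    rcases Finset.mem_insert.1 ha with rfl | ha
    · obtain ⟨k, hk⟩ := hσne
      exact ⟨_, (hmem _).2 (Or.inr ⟨true, t₀, ht₀, by simpa [hτ] using hσ0, k,
        by simpa [hτ] using hk,
        rfl⟩), by simp⟩
    · obtain ⟨t, ht, hat⟩ := h.cover a ha
      by_cases hb : ∃ b, τ b ⊆ t
      · obtain ⟨b, hb⟩ := hb
        obtain ⟨k, hk, hka⟩ := hτ1 b (a, true)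
        exact ⟨_, (hmem _).2 (Or.inr ⟨b, t, ht, hb, k, hk, rfl⟩),
          Finset.mem_insert_of_mem (Finset.mem_erase.2 ⟨Ne.symm hka, hat⟩)⟩
      · exact ⟨t, (hmem t).2 (Or.inl ⟨ht, by simpa using hb⟩), hat⟩

/-- The relabelling that turns signed simplices on the vectors `signed v (f a, ε a)` into signed
simplices on the vectors `v b`: a false `ε a` exchanges the two labels over `a`. -/
def relabel (f : α ↪ β) (ε : α → Bool) : α × Bool ↪ β × Bool where
  toFun i := (f i.1, i.2 == ε i.1)
  inj' := by
    rintro ⟨a, b⟩ ⟨a', b'⟩ h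
    simp only [Prod.mk.injEq, f.injective.eq_iff] at h
    obtain ⟨rfl, h⟩ := h
    revert h
    cases b <;> cases b' <;> cases ε a <;> simp

@[simp] lemma relabel_apply (f : α ↪ β) (ε : α → Bool) (i : α × Bool) :
    relabel f ε i = (f i.1, i.2 == ε i.1) := rfl

lemma signed_relabel (f : α ↪ β) (ε : α → Bool) (v : β → E3) (i : α × Bool) :
    signed v (relabel f ε i) = signed (fun a => signed v (f a, ε a)) i := by
  rcases i with ⟨a, _ | _⟩ <;> cases h : ε a <;> simp [signed, h]

lemma relabel_opp (f : α ↪ β) (ε : α → Bool) (i : α × Bool) :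
    relabel f ε (opp i) = opp (relabel f ε i) := by
  rcases i with ⟨a, _ | _⟩ <;> cases h : ε a <;> simp [opp, h]

theorem IsFan.map {ι κ : Type*} [Fintype ι] [Fintype κ] [DecidableEq κ] (e : ι ↪ κ) {u : κ → E3}
    {T : Finset (Finset ι)} (h : IsFan (fun i => u (e i)) T) :
    IsFan u (T.image (Finset.map e)) := by
  have hsum : ∀ c : κ → ℝ, (∀ k, k ∉ Set.range e → c k = 0) →
      ∑ k, c k • u k = ∑ i, c (e i) • u (e i) := by
    intro c hc
    rw [← Finset.sum_map Finset.univ e (fun k => c k • u k)]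
    symm
    refine Finset.sum_subset (Finset.subset_univ _) fun k _ hk => ?_
    rw [hc k (by simpa using hk), zero_smul]
  have hzero : ∀ c, IsCoord (T.image (Finset.map e)) c → ∀ k, k ∉ Set.range e → c k = 0 := by
    rintro c ⟨-, t, ht, hct⟩ k hk
    obtain ⟨s, -, rfl⟩ := Finset.mem_image.1 ht
    refine hct k fun hks => hk ?_
    obtain ⟨i, -, rfl⟩ := Finset.mem_map.1 hks
    exact ⟨i, rfl⟩
  have hdown : ∀ c, IsCoord (T.image (Finset.map e)) c → IsCoord T fun i => c (e i) := by
    rintro c ⟨hc, t, ht, hct⟩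
    obtain ⟨s, hs, rfl⟩ := Finset.mem_image.1 ht
    exact ⟨fun i => hc _, s, hs, fun i hi => hct _ (by simpa using hi)⟩
  constructor
  · intro x
    obtain ⟨c, ⟨hc, t, ht, hct⟩, hx⟩ := h.exists_coord x
    have hext : ∀ i, Function.extend e c 0 (e i) = c i := fun i => e.injective.extend_apply c 0 i
    refine ⟨Function.extend e c 0, ⟨fun k => ?_, _, Finset.mem_image_of_mem _ ht, fun k hk => ?_⟩, ?_⟩
    · by_cases hk : ∃ i, e i = k
      · obtain ⟨i, rfl⟩ := hk
        rw [hext]; exact hc i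
      · rw [Function.extend_apply' _ _ _ hk]; rfl
    · by_cases hk' : ∃ i, e i = k
      · obtain ⟨i, rfl⟩ := hk'
        rw [hext]; exact hct i (by simpa using hk)
      · rw [Function.extend_apply' _ _ _ hk']; rfl
    · rw [hsum _ fun k hk => Function.extend_apply' c (0 : κ → ℝ) k hk, ← hx]
      simp only [hext]
  · intro c d hc hd hcd
    have := h.unique _ _ (hdown c hc) (hdown d hd)
      (by rw [← hsum c (hzero c hc), ← hsum d (hzero d hd), hcd])
    funext k
    by_cases hk : ∃ i, e i = k
    · obtain ⟨i, rfl⟩ := hk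
      exact congrFun this i
    · rw [hzero c hc k hk, hzero d hd k hk]

theorem IsProjFan.map [Fintype α] [Fintype β] [DecidableEq α] [DecidableEq β] (f : α ↪ β)
    (ε : α → Bool) {v : β → E3} {Q : Finset α} {T : Finset (Finset (α × Bool))}
    (h : IsProjFan (fun a => signed v (f a, ε a)) Q T) :
    IsProjFan v (Q.map f) (T.image (Finset.map (relabel f ε))) := by
  have hopp : ∀ i (t : Finset (α × Bool)),
      opp (relabel f ε i) ∈ t.map (relabel f ε) ↔ opp i ∈ t := by
    intro i t
    rw [← relabel_opp, Finset.mem_map']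
  refine ⟨IsFan.map _ ?_, ?_, ?_, ?_, ?_, ?_⟩
  · simpa only [signed_relabel] using h.fan
  · intro t ht
    obtain ⟨s, hs, rfl⟩ := Finset.mem_image.1 ht
    refine Finset.mem_image.2 ⟨_, h.symm s hs, ?_⟩
    rw [Finset.map_eq_image, Finset.map_eq_image, Finset.image_image, Finset.image_image]
    exact Finset.image_congr fun i _ => relabel_opp f ε i
  · intro t ht
    obtain ⟨s, hs, rfl⟩ := Finset.mem_image.1 ht
    rw [Finset.card_map, h.card s hs]
  · intro s hs t ht i his hit j hjs hjt
    obtain ⟨s', hs', rfl⟩ := Finset.mem_image.1 hs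
    obtain ⟨t', ht', rfl⟩ := Finset.mem_image.1 ht
    obtain ⟨i, hi, rfl⟩ := Finset.mem_map.1 his
    obtain ⟨j, hj, rfl⟩ := Finset.mem_map.1 hjs
    exact h.simple s' hs' t' ht' i hi ((Finset.mem_map' _).1 hit) j hj ((hopp j t').1 hjt)
  · intro t ht i hi
    obtain ⟨s, hs, rfl⟩ := Finset.mem_image.1 ht
    obtain ⟨j, hj, rfl⟩ := Finset.mem_map.1 hi
    exact Finset.mem_map_of_mem f (h.mem s hs j hj)
  · intro b hb
    obtain ⟨a, ha, rfl⟩ := Finset.mem_map.1 hb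
    obtain ⟨t, ht, hat⟩ := h.cover a ha
    by_cases hε : ε a
    · refine ⟨_, Finset.mem_image_of_mem _ ht, Finset.mem_map.2 ⟨_, hat, by simp [hε]⟩⟩
    · refine ⟨_, Finset.mem_image_of_mem _ (h.symm t ht), Finset.mem_map.2
        ⟨(a, false), mem_image_opp.2 hat, by simp [hε]⟩⟩

end Symmetric

/-! ### Determinants -/

/-- The determinant of three vectors of three-space. -/
def tdet (x y z : E3) : ℝ :=
  x 0 * (y 1 * z 2 - y 2 * z 1) - x 1 * (y 0 * z 2 - y 2 * z 0) + x 2 * (y 0 * z 1 - y 1 * z 0)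

/-- Cramer's rule, as the linear relation between four vectors. -/
lemma cramer (a b c d : E3) :
    tdet b c d • a - tdet a c d • b + tdet a b d • c - tdet a b c • d = 0 := by
  ext i
  fin_cases i <;> simp [tdet] <;> ring

lemma tdet_comb_left (r s t : ℝ) (a b c y z : E3) :
    tdet (r • a + s • b + t • c) y z = r * tdet a y z + s * tdet b y z + t * tdet c y z := by
  simp [tdet]; ring

lemma tdet_rotate (x y z : E3) : tdet x y z = tdet y z x := by
  simp only [tdet]; ring

lemma tdet_self_left (x z : E3) : tdet x x z = 0 := by
  simp only [tdet]; ring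

lemma tdet_self_outer (x z : E3) : tdet x z x = 0 := by
  simp only [tdet]; ring

lemma eq_zero_of_comb_eq_zero {a b c : E3} (h : tdet a b c ≠ 0) {r s t : ℝ}
    (h0 : r • a + s • b + t • c = 0) : r = 0 ∧ s = 0 ∧ t = 0 := by
  have h00 : ∀ y z : E3, tdet 0 y z = 0 := by simp [tdet]
  have h1 := tdet_comb_left r s t a b c b c
  have h2 := tdet_comb_left r s t a b c c a
  have h3 := tdet_comb_left r s t a b c a b
  rw [h0, h00, tdet_self_left, tdet_self_outer] at h1
  rw [h0, h00, tdet_self_left, tdet_self_outer, ← tdet_rotate a b c] at h2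
  rw [h0, h00, tdet_self_left, tdet_self_outer, tdet_rotate c a b] at h3
  exact ⟨by simpa [h] using h1, by simpa [h] using h2, by simpa [h] using h3⟩

lemma exists_comb {a b c : E3} (h : tdet a b c ≠ 0) (x : E3) :
    ∃ r s t : ℝ, x = r • a + s • b + t • c := by
  refine ⟨tdet b c x / tdet a b c, -tdet a c x / tdet a b c, tdet a b x / tdet a b c, ?_⟩
  have h1 := cramer a b c x
  have h2 : tdet a b c • x = tdet b c x • a - tdet a c x • b + tdet a b x • c := by
    rw [← sub_eq_zero, ← neg_eq_zero, ← h1]; abel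
  calc x = (tdet a b c)⁻¹ • tdet a b c • x := (inv_smul_smul₀ h x).symm
    _ = _ := by rw [h2]; module

/-! ### The fan of a basis -/

section Octants

variable {α : Type*} [DecidableEq α]

/-- The eight octants of the coordinate system with axes `p`, `q` and `r`. -/
def octants (p q r : α) : Finset (Finset (α × Bool)) :=
  (Finset.univ : Finset (Bool × Bool × Bool)).image fun s => {(p, s.1), (q, s.2.1), (r, s.2.2)}

theorem isFan_octants [Fintype α] {v : α → E3} {p q r : α} (hpq : p ≠ q) (hqr : q ≠ r) (hpr : p ≠ r)
    (h : tdet (v p) (v q) (v r) ≠ 0) : IsFan (signed v) (octants p q r) := by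
  have hmem : ∀ t, t ∈ octants p q r ↔ ∃ x y z, {(p, x), (q, y), (r, z)} = t := by
    intro t
    simp only [octants, Finset.mem_image, Finset.mem_univ, true_and, Prod.exists]
  have hsum : ∀ c : α × Bool → ℝ, (∀ a, a ≠ p → a ≠ q → a ≠ r → ∀ b, c (a, b) = 0) →
      ∑ i, c i • signed v i = (c (p, true) - c (p, false)) • v p +
        (c (q, true) - c (q, false)) • v q + (c (r, true) - c (r, false)) • v r := by
    intro c hc
    rw [Fintype.sum_prod_type, ← Finset.sum_subset (Finset.subset_univ {p, q, r})]
    · rw [Finset.sum_insert (by simp [hpq, hpr]), Finset.sum_insert (by simp [hqr]),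
        Finset.sum_singleton]
      simp only [Fintype.sum_bool, signed, if_true, Bool.false_eq_true, if_false]
      module
    · intro a _ ha
      simp only [Finset.mem_insert, Finset.mem_singleton, not_or] at ha
      simp [hc a ha.1 ha.2.1 ha.2.2]
  have hzero : ∀ c, IsCoord (octants p q r) c →
      (∀ a, a ≠ p → a ≠ q → a ≠ r → ∀ b, c (a, b) = 0) ∧
      (c (p, true) = 0 ∨ c (p, false) = 0) ∧ (c (q, true) = 0 ∨ c (q, false) = 0) ∧
      (c (r, true) = 0 ∨ c (r, false) = 0) := by
    rintro c ⟨hc, t, ht, hct⟩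
    obtain ⟨x, y, z, rfl⟩ := (hmem t).1 ht
    refine ⟨fun a h1 h2 h3 b => hct _ (by simp [h1, h2, h3]), ?_, ?_, ?_⟩
    · cases x
      · exact Or.inl (hct _ (by simp [hpq, hpr]))
      · exact Or.inr (hct _ (by simp [hpq, hpr]))
    · cases y
      · exact Or.inl (hct _ (by simp [hpq.symm, hqr]))
      · exact Or.inr (hct _ (by simp [hpq.symm, hqr]))
    · cases z
      · exact Or.inl (hct _ (by simp [hpr.symm, hqr.symm]))
      · exact Or.inr (hct _ (by simp [hpr.symm, hqr.symm]))
  constructor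
  · intro x
    obtain ⟨α₁, β, γ, rfl⟩ := exists_comb h x
    -- The coefficients are the positive and the negative parts of the coordinates.
    set k : α → ℝ := fun a => if a = p then α₁ else if a = q then β else if a = r then γ else 0
      with hk
    have kp : k p = α₁ := by simp [hk]
    have kq : k q = β := by simp [hk, hpq.symm]
    have kr : k r = γ := by simp [hk, hpr.symm, hqr.symm]
    set c : α × Bool → ℝ := fun i => if i.2 then max (k i.1) 0 else max (-k i.1) 0 with hc
    have hdiff : ∀ a, c (a, true) - c (a, false) = k a := by
      intro a
      simp only [hc, if_true, Bool.false_eq_true, if_false]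
      rcases le_total 0 (k a) with h | h
      · rw [max_eq_left h, max_eq_right (by linarith)]; ring
      · rw [max_eq_right h, max_eq_left (by linarith)]; ring
    have hoff : ∀ a b, b ≠ decide (0 ≤ k a) → c (a, b) = 0 := by
      intro a b hb
      cases b
      · have : 0 ≤ k a := by simpa using hb
        simp [hc, this]
      · have : k a < 0 := by simpa using hb
        simp [hc, this.le]
    refine ⟨c, ⟨fun i => ?_, _, (hmem _).2 ⟨decide (0 ≤ k p), decide (0 ≤ k q), decide (0 ≤ k r), rfl⟩,
      ?_⟩, ?_⟩
    · rcases i with ⟨a, _ | _⟩ <;> simp [hc]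
    · rintro ⟨a, b⟩ hi
      simp only [Finset.mem_insert, Finset.mem_singleton, Prod.mk.injEq, not_or, not_and] at hi
      by_cases hp : a = p
      · subst hp; exact hoff _ _ (hi.1 rfl)
      by_cases hq : a = q
      · subst hq; exact hoff _ _ (hi.2.1 rfl)
      by_cases hr : a = r
      · subst hr; exact hoff _ _ (hi.2.2 rfl)
      · cases b <;> simp [hc, hk, hp, hq, hr]
    · rw [hsum c, hdiff, hdiff, hdiff, kp, kq, kr]
      intro a h1 h2 h3 b
      cases b <;> simp [hc, hk, h1, h2, h3]
  · intro c d hc hd hcd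
    obtain ⟨hc0, hcp, hcq, hcr⟩ := hzero c hc
    obtain ⟨hd0, hdp, hdq, hdr⟩ := hzero d hd
    rw [hsum c hc0, hsum d hd0] at hcd
    have h0 : ((c (p, true) - c (p, false)) - (d (p, true) - d (p, false))) • v p +
        ((c (q, true) - c (q, false)) - (d (q, true) - d (q, false))) • v q +
        ((c (r, true) - c (r, false)) - (d (r, true) - d (r, false))) • v r = 0 := by
      rw [← sub_eq_zero] at hcd
      rw [← hcd]
      module
    obtain ⟨h1, h2, h3⟩ := eq_zero_of_comb_eq_zero h h0
    have hax : ∀ a, (c (a, true) = 0 ∨ c (a, false) = 0) → (d (a, true) = 0 ∨ d (a, false) = 0) →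
        (c (a, true) - c (a, false)) - (d (a, true) - d (a, false)) = 0 →
        ∀ b, c (a, b) = d (a, b) := by
      intro a hca hda hcd b
      have := hc.1 (a, true)
      have := hc.1 (a, false)
      have := hd.1 (a, true)
      have := hd.1 (a, false)
      cases b <;> rcases hca with h | h <;> rcases hda with h' | h' <;> linarith
    funext ⟨a, b⟩
    by_cases hp : a = p
    · subst hp; exact hax _ hcp hdp h1 b
    by_cases hq : a = q
    · subst hq; exact hax _ hcq hdq h2 b
    by_cases hr : a = r
    · subst hr; exact hax _ hcr hdr h3 b
    · rw [hc0 a hp hq hr, hd0 a hp hq hr]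

end Octants

/-! ### Antipodal pairs of flips -/

/-- Membership-bounded quantifiers over sets of simplices are decided by enumerating the simplices,
instead of all sets of labels. -/
local instance decidableForallSimplex {α : Type*} (T : Finset (Finset (α × Bool)))
    (P : Finset (α × Bool) → Prop) [DecidablePred P] : Decidable (∀ t ∈ T, P t) :=
  Finset.decidableDforallFinset

/-- See `decidableForallSimplex`. -/
local instance decidableExistsSimplex {α : Type*} (T : Finset (Finset (α × Bool)))
    (P : Finset (α × Bool) → Prop) [DecidablePred P] : Decidable (∃ t ∈ T, P t) :=
  Finset.decidableExistsAndFinset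

section Pairs

variable {α : Type*} [Fintype α] [DecidableEq α]

/-- Two antipodal stellar subdivisions of triangles, at `w` and at `opp w`. -/
def stellarPair (T : Finset (Finset (α × Bool))) (x y z w : α × Bool) :
    Finset (Finset (α × Bool)) :=
  stellar (stellar T {x, y, z} w) {opp x, opp y, opp z} (opp w)

/-- Two antipodal flips of edges, from `a c` to `b d` and from `opp a`, `opp c` to
`opp b`, `opp d`. -/
def flipPair (T : Finset (Finset (α × Bool))) (a c b d : α × Bool) : Finset (Finset (α × Bool)) :=
  flip (flip T a c b d) (opp a) (opp c) (opp b) (opp d)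

/-- The combinatorial condition for a stellar subdivision of the triangle `x y z` at `w`. -/
abbrev CanSubdivide (T : Finset (Finset (α × Bool))) (x y z w : α × Bool) : Prop :=
  (∀ t ∈ T, w ∉ t) ∧ [x, y, z, w].Nodup

/-- The combinatorial condition for the flip from `a c` to `b d`: the triangles `a c b` and
`a c d` are present, and are the only ones that contain `a c`. -/
abbrev CanFlip (T : Finset (Finset (α × Bool))) (a c b d : α × Bool) : Prop :=
  [a, c, b, d].Nodup ∧ (∀ t ∈ T, {a, c} ⊆ t → t = {a, c, b} ∨ t = {a, c, d}) ∧
    {a, c, b} ∈ T ∧ {a, c, d} ∈ T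

theorem IsFan.stellar_triangle {v : α → E3} {T : Finset (Finset (α × Bool))}
    (hT : IsFan (signed v) T) {x y z w : α × Bool} (h : CanSubdivide T x y z w)
    {r s t : ℝ} (hr : 0 < r) (hs : 0 < s) (ht : 0 < t)
    (hw : signed v w = r • signed v x + s • signed v y + t • signed v z) :
    IsFan (signed v) (ProjTri.stellar T {x, y, z} w) := by
  obtain ⟨h1, h2⟩ := h
  simp only [List.nodup_cons, List.mem_cons, List.not_mem_nil, or_false, not_or,
    List.nodup_nil, not_false_eq_true, and_true] at h2
  obtain ⟨⟨hxy, hxz, hxw⟩, ⟨hyz, hyw⟩, hzw⟩ := h2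
  refine hT.stellar h1 (by simp [Ne.symm hxw, Ne.symm hyw, Ne.symm hzw]) (by simp)
    (c := fun i => if i = x then r else if i = y then s else t) ?_ ?_
  · intro i _
    split_ifs <;> assumption
  · rw [Finset.sum_insert (by simp [hxy, hxz]), Finset.sum_insert (by simp [hyz]),
      Finset.sum_singleton, hw]
    simp [Ne.symm hxy, Ne.symm hxz, Ne.symm hyz, add_assoc]

theorem IsFan.stellarPair {v : α → E3} {T : Finset (Finset (α × Bool))}
    (hT : IsFan (signed v) T) (x y z w : α × Bool) (h : CanSubdivide T x y z w)
    (h' : CanSubdivide (ProjTri.stellar T {x, y, z} w) (opp x) (opp y) (opp z) (opp w))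
    (hw : ∃ μ r s t : ℝ, 0 < μ ∧ 0 < r ∧ 0 < s ∧ 0 < t ∧
      μ • signed v w = r • signed v x + s • signed v y + t • signed v z) :
    IsFan (signed v) (ProjTri.stellarPair T x y z w) := by
  obtain ⟨μ, r, s, t, hμ, hr, hs, ht, hw⟩ := hw
  have hw' : signed v w = (r / μ) • signed v x + (s / μ) • signed v y + (t / μ) • signed v z := by
    rw [← inv_smul_smul₀ hμ.ne' (signed v w), hw]
    module
  refine (hT.stellar_triangle h (div_pos hr hμ) (div_pos hs hμ) (div_pos ht hμ) hw').stellar_triangle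
    h' (div_pos hr hμ) (div_pos hs hμ) (div_pos ht hμ) ?_
  simp only [signed_opp, hw']
  module

theorem IsFan.flipPair {v : α → E3} {T : Finset (Finset (α × Bool))}
    (hT : IsFan (signed v) T) (a c b d : α × Bool) (h : CanFlip T a c b d)
    (h' : CanFlip (ProjTri.flip T a c b d) (opp a) (opp c) (opp b) (opp d))
    (hrel : ∃ μ ν r s : ℝ, 0 < μ ∧ 0 < ν ∧ 0 < r ∧ 0 < s ∧
      μ • signed v a + ν • signed v c = r • signed v b + s • signed v d) :
    IsFan (signed v) (ProjTri.flipPair T a c b d) := by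
  refine (hT.flip a c b d h.1 h.2.1 h.2.2 hrel).flip _ _ _ _ h'.1 h'.2.1 h'.2.2 ?_
  obtain ⟨μ, ν, r, s, hμ, hν, hr, hs, hrel⟩ := hrel
  refine ⟨μ, ν, r, s, hμ, hν, hr, hs, ?_⟩
  simp only [signed_opp, smul_neg, ← neg_add, hrel]

end Pairs

/-! ### Six points, five of which span a convex pentagon -/

/-- Five vectors that are the vertices, in this order, of a convex pentagon. -/
structure IsPentagon (a b c d e : E3) : Prop where
  abc : 0 < tdet a b c
  abd : 0 < tdet a b d
  abe : 0 < tdet a b e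
  acd : 0 < tdet a c d
  ace : 0 < tdet a c e
  ade : 0 < tdet a d e
  bcd : 0 < tdet b c d
  bce : 0 < tdet b c e
  bde : 0 < tdet b d e
  cde : 0 < tdet c d e

lemma IsPentagon.rotate {a b c d e : E3} (h : IsPentagon a b c d e) : IsPentagon b c d e a := by
  constructor
  · exact h.bcd
  · exact h.bce
  · rw [← tdet_rotate]; exact h.abc
  · exact h.bde
  · rw [← tdet_rotate]; exact h.abd
  · rw [← tdet_rotate]; exact h.abe
  · exact h.cde
  · rw [← tdet_rotate]; exact h.acd
  · rw [← tdet_rotate]; exact h.ace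
  · rw [← tdet_rotate]; exact h.ade

/-- The label of the `i`-th of six vectors. -/
abbrev pos (i : Fin 6) : Fin 6 × Bool := (i, true)

/-- The label of the antipode of the `i`-th of six vectors. -/
abbrev neg (i : Fin 6) : Fin 6 × Bool := (i, false)

/-- One triangle from each antipodal pair of `pentagonFan`: three triangles that subdivide the
pentagon, and five triangles, each with one edge of the pentagon and the opposite vertex, that
subdivide the Möbius band outside of the pentagon. -/
def pentagonTriangles : List ((Fin 6 × Bool) × (Fin 6 × Bool) × (Fin 6 × Bool)) :=
  [(pos 0, pos 1, pos 2), (pos 0, pos 2, pos 3), (pos 0, pos 3, pos 4),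
    (pos 0, pos 1, neg 3), (pos 1, pos 2, neg 4), (pos 2, pos 3, neg 0), (pos 3, pos 4, neg 1),
    (pos 4, pos 0, neg 2)]

/-- A fan on the five vertices of a convex pentagon. Its quotient by the antipodal map is not a
simplicial complex: both arcs between the vertices `0` and `2`, and both arcs
between `0` and `3`, are edges. -/
def pentagonFan : Finset (Finset (Fin 6 × Bool)) :=
  (pentagonTriangles.map fun q => {q.1, q.2.1, q.2.2}).toFinset ∪
    (pentagonTriangles.map fun q => {opp q.1, opp q.2.1, opp q.2.2}).toFinset

/-- The octants of the basis `0`, `2`, `3` are subdivided at the vertices `1` and `4`, and the outer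
arc between `2` and `3` is flipped to the one between `1` and `4`. -/
theorem isFan_pentagonFan {v : Fin 6 → E3} (h : IsPentagon (v 0) (v 1) (v 2) (v 3) (v 4)) :
    IsFan (signed v) pentagonFan := by
  have h0 : IsFan (signed v) (octants (0 : Fin 6) 2 3) :=
    isFan_octants (by decide) (by decide) (by decide) h.acd.ne'
  have h1 := h0.stellarPair (pos 0) (pos 2) (neg 3) (pos 1) (by decide +kernel) (by decide +kernel)
    ⟨_, _, _, _, h.acd, h.bcd, h.abd, h.abc, by
      have := cramer (v 0) (v 1) (v 2) (v 3)
      simp [signed]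
      linear_combination (norm := module) -this⟩
  have h2 := h1.stellarPair (pos 0) (neg 2) (pos 3) (pos 4) (by decide +kernel) (by decide +kernel)
    ⟨_, _, _, _, h.acd, h.cde, h.ade, h.ace, by
      have := cramer (v 0) (v 2) (v 3) (v 4)
      simp [signed]
      linear_combination (norm := module) -this⟩
  have h3 := h2.flipPair (pos 2) (neg 3) (pos 1) (neg 4) (by decide +kernel) (by decide +kernel)
    ⟨_, _, _, _, h.bde, h.bce, h.cde, h.bcd, by
      have := cramer (v 1) (v 2) (v 3) (v 4)
      simp [signed]
      linear_combination (norm := module) -this⟩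
  convert h3 using 1
  decide +kernel
/-- Some projective fan has the six vectors, up to sign, as its rays. -/
def HasProjFan (v : Fin 6 → E3) : Prop := ∃ T, IsProjFan v Finset.univ T

/-- The remaining conditions on a projective fan with six vertices are finite checks. -/
lemma HasProjFan.of_isFan {v : Fin 6 → E3} {T : Finset (Finset (Fin 6 × Bool))}
    (h : IsFan (signed v) T) (h' : (∀ t ∈ T, t.image opp ∈ T) ∧ (∀ t ∈ T, t.card = 3) ∧
      (∀ s ∈ T, ∀ t ∈ T, ∀ i ∈ s, i ∈ t → ∀ j ∈ s, opp j ∉ t) ∧ ∀ a, ∃ t ∈ T, pos a ∈ t) :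
    HasProjFan v :=
  ⟨T, h, h'.1, h'.2.1, h'.2.2.1, by simp, fun a _ => h'.2.2.2 a⟩

/-- The sixth point lies outside of the pentagon, in a triangle of the Möbius band. One flip inside
removes the inner copy of the edge `0 2`, and two flips outside remove the outer copy of `0 3` and
the outer copy of `1 3`, whose inner copy arises from the first flip. -/
lemma hasProjFan_of_outside {v : Fin 6 → E3} (h : IsPentagon (v 0) (v 1) (v 2) (v 3) (v 4))
    {a b c : ℝ} (ha : 0 < a) (hb : 0 < b) (hc : 0 < c)
    (h5 : v 5 = a • v 0 + b • v 1 - c • v 3) : HasProjFan v := by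
  have h0 := isFan_pentagonFan h
  obtain ⟨h012, h013, h014, h023, h024, h034, h123, h124, h134, h234⟩ := h
  have e3 := cramer (v 0) (v 1) (v 2) (v 3)
  have e2 := cramer (v 0) (v 1) (v 3) (v 4)
  have h1 := h0.stellarPair (pos 0) (pos 1) (neg 3) (pos 5) (by decide +kernel) (by decide +kernel)
    ⟨1, a, b, c, one_pos, ha, hb, hc, by simp [signed, h5]; abel⟩
  have h2 := h1.flipPair (pos 0) (pos 2) (pos 1) (pos 3) (by decide +kernel) (by decide +kernel)
    ⟨_, _, _, _, h123, h013, h023, h012, by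
      simp [signed]
      linear_combination (norm := module) e3⟩
  have h3 := h2.flipPair (pos 0) (neg 3) (pos 5) (neg 2) (by decide +kernel) (by decide +kernel)
    ⟨a * tdet (v 0) (v 2) (v 3) + b * tdet (v 1) (v 2) (v 3),
      b * tdet (v 0) (v 1) (v 2) + c * tdet (v 0) (v 2) (v 3), tdet (v 0) (v 2) (v 3),
      b * tdet (v 0) (v 1) (v 3), by positivity, by positivity, by positivity, by positivity, by
      simp [signed, h5]
      linear_combination (norm := module) b • e3⟩
  have h4 := h3.flipPair (pos 1) (neg 3) (pos 5) (neg 4) (by decide +kernel) (by decide +kernel)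
    ⟨a * tdet (v 0) (v 3) (v 4) + b * tdet (v 1) (v 3) (v 4),
      a * tdet (v 0) (v 1) (v 4) + c * tdet (v 1) (v 3) (v 4), tdet (v 1) (v 3) (v 4),
      a * tdet (v 0) (v 1) (v 3), by positivity, by positivity, by positivity, by positivity, by
      simp [signed, h5]
      linear_combination (norm := module) -a • e2⟩
  exact .of_isFan h4 (by decide +kernel)

/-- The sixth point lies in a triangle cut off from the pentagon by a diagonal. Flipping the two
inner diagonals turns the triangulation of the pentagon into the cone from the sixth point over its
boundary. -/
lemma hasProjFan_of_ear {v : Fin 6 → E3} (h : IsPentagon (v 0) (v 1) (v 2) (v 3) (v 4))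
    {a b c : ℝ} (ha : 0 < a) (hb : 0 < b) (hc : 0 < c)
    (h5 : v 5 = a • v 0 + b • v 1 + c • v 2) : HasProjFan v := by
  have h0 := isFan_pentagonFan h
  obtain ⟨h012, h013, h014, h023, h024, h034, h123, h124, h134, h234⟩ := h
  have e4 := cramer (v 0) (v 1) (v 2) (v 3)
  have e2 := cramer (v 0) (v 1) (v 3) (v 4)
  have e1 := cramer (v 0) (v 2) (v 3) (v 4)
  have h1 := h0.stellarPair (pos 0) (pos 1) (pos 2) (pos 5) (by decide +kernel) (by decide +kernel)
    ⟨1, a, b, c, one_pos, ha, hb, hc, by simp [signed, h5]⟩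
  have h2 := h1.flipPair (pos 0) (pos 2) (pos 5) (pos 3) (by decide +kernel) (by decide +kernel)
    ⟨a * tdet (v 0) (v 2) (v 3) + b * tdet (v 1) (v 2) (v 3),
      b * tdet (v 0) (v 1) (v 3) + c * tdet (v 0) (v 2) (v 3), tdet (v 0) (v 2) (v 3),
      b * tdet (v 0) (v 1) (v 2), by positivity, by positivity, by positivity, by positivity, by
      simp [signed, h5]
      linear_combination (norm := module) b • e4⟩
  have h3 := h2.flipPair (pos 0) (pos 3) (pos 5) (pos 4) (by decide +kernel) (by decide +kernel)
    ⟨a * tdet (v 0) (v 3) (v 4) + b * tdet (v 1) (v 3) (v 4) + c * tdet (v 2) (v 3) (v 4),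
      b * tdet (v 0) (v 1) (v 4) + c * tdet (v 0) (v 2) (v 4), tdet (v 0) (v 3) (v 4),
      b * tdet (v 0) (v 1) (v 3) + c * tdet (v 0) (v 2) (v 3),
      by positivity, by positivity, by positivity, by positivity, by
      simp [signed, h5]
      linear_combination (norm := module) b • e2 + c • e1⟩
  exact .of_isFan h3 (by decide +kernel)

/-- The sixth point lies in the middle triangle of the pentagon. Again the two flips of the inner
diagonals yield the cone from the sixth point over the boundary of the pentagon. -/
lemma hasProjFan_of_middle {v : Fin 6 → E3} (h : IsPentagon (v 0) (v 1) (v 2) (v 3) (v 4))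
    {a b c : ℝ} (ha : 0 < a) (hb : 0 < b) (hc : 0 < c)
    (h5 : v 5 = a • v 0 + b • v 2 + c • v 3) : HasProjFan v := by
  have h0 := isFan_pentagonFan h
  obtain ⟨h012, h013, h014, h023, h024, h034, h123, h124, h134, h234⟩ := h
  have e4 := cramer (v 0) (v 1) (v 2) (v 3)
  have e1 := cramer (v 0) (v 2) (v 3) (v 4)
  have h1 := h0.stellarPair (pos 0) (pos 2) (pos 3) (pos 5) (by decide +kernel) (by decide +kernel)
    ⟨1, a, b, c, one_pos, ha, hb, hc, by simp [signed, h5]⟩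
  have h2 := h1.flipPair (pos 0) (pos 2) (pos 5) (pos 1) (by decide +kernel) (by decide +kernel)
    ⟨a * tdet (v 0) (v 1) (v 2) + c * tdet (v 1) (v 2) (v 3),
      b * tdet (v 0) (v 1) (v 2) + c * tdet (v 0) (v 1) (v 3), tdet (v 0) (v 1) (v 2),
      c * tdet (v 0) (v 2) (v 3), by positivity, by positivity, by positivity, by positivity, by
      simp [signed, h5]
      linear_combination (norm := module) c • e4⟩
  have h3 := h2.flipPair (pos 0) (pos 3) (pos 5) (pos 4) (by decide +kernel) (by decide +kernel)
    ⟨a * tdet (v 0) (v 3) (v 4) + b * tdet (v 2) (v 3) (v 4),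
      b * tdet (v 0) (v 2) (v 4) + c * tdet (v 0) (v 3) (v 4), tdet (v 0) (v 3) (v 4),
      b * tdet (v 0) (v 2) (v 3), by positivity, by positivity, by positivity, by positivity, by
      simp [signed, h5]
      linear_combination (norm := module) b • e1⟩
  exact .of_isFan h3 (by decide +kernel)

lemma HasProjFan.of_relabel {v : Fin 6 → E3} (f : Fin 6 → Fin 6) (hf : Function.Injective f)
    (ε : Fin 6 → Bool) (h : HasProjFan fun a => signed v (f a, ε a)) : HasProjFan v := by
  obtain ⟨T, hT⟩ := h
  have := IsProjFan.map ⟨f, hf⟩ ε (v := v) hT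
  rw [Finset.eq_univ_of_card (Finset.univ.map _) (Finset.card_map _)] at this
  exact ⟨_, this⟩

/-- The sixth point lies in one of the triangles of the pentagon fan. A rotation of the pentagon
brings this triangle to one of the three standard positions. -/
lemma hasProjFan_of_mem_triangle {v : Fin 6 → E3}
    (h : IsPentagon (v 0) (v 1) (v 2) (v 3) (v 4)) {x y z : Fin 6 × Bool}
    (hq : (x, y, z) ∈ pentagonTriangles) {r s t : ℝ} (hr : 0 < r) (hs : 0 < s) (ht : 0 < t)
    (h5 : v 5 = r • signed v x + s • signed v y + t • signed v z) : HasProjFan v := by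
  have neg_eq : ∀ i, signed v (neg i) = -v i := fun i => rfl
  have pos_eq : ∀ i, signed v (pos i) = v i := fun i => rfl
  simp only [pentagonTriangles, List.mem_cons, Prod.mk.injEq, List.not_mem_nil, or_false] at hq
  rcases hq with ⟨rfl, rfl, rfl⟩ | ⟨rfl, rfl, rfl⟩ | ⟨rfl, rfl, rfl⟩ | ⟨rfl, rfl, rfl⟩ |
    ⟨rfl, rfl, rfl⟩ | ⟨rfl, rfl, rfl⟩ | ⟨rfl, rfl, rfl⟩ | ⟨rfl, rfl, rfl⟩ <;>
    simp only [neg_eq, pos_eq, smul_neg, ← sub_eq_add_neg] at h5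
  · exact hasProjFan_of_ear h hr hs ht h5
  · exact hasProjFan_of_middle h hr hs ht h5
  · exact .of_relabel ![3, 4, 0, 1, 2, 5] (by decide) (fun _ => true)
      (hasProjFan_of_ear h.rotate.rotate.rotate hs ht hr
        (by rw [add_assoc, add_comm] at h5; exact h5))
  · exact hasProjFan_of_outside h hr hs ht h5
  · exact .of_relabel ![1, 2, 3, 4, 0, 5] (by decide) (fun _ => true)
      (hasProjFan_of_outside h.rotate hr hs ht h5)
  · exact .of_relabel ![2, 3, 4, 0, 1, 5] (by decide) (fun _ => true)
      (hasProjFan_of_outside h.rotate.rotate hr hs ht h5)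
  · exact .of_relabel ![3, 4, 0, 1, 2, 5] (by decide) (fun _ => true)
      (hasProjFan_of_outside h.rotate.rotate.rotate hr hs ht h5)
  · exact .of_relabel ![4, 0, 1, 2, 3, 5] (by decide) (fun _ => true)
      (hasProjFan_of_outside h.rotate.rotate.rotate.rotate hr hs ht h5)

/-- No three of the vectors are linearly dependent. -/
def IsGeneric {α : Type*} (v : α → E3) : Prop :=
  ∀ i j k, i ≠ j → j ≠ k → i ≠ k → tdet (v i) (v j) (v k) ≠ 0

lemma tdet_signed_ne_zero {α : Type*} {v : α → E3} (x y z : α × Bool)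
    (h : tdet (v x.1) (v y.1) (v z.1) ≠ 0) : tdet (signed v x) (signed v y) (signed v z) ≠ 0 := by
  have hs : ∀ i : α × Bool, ∃ e : ℝ, e ≠ 0 ∧ signed v i = e • v i.1 := by
    rintro ⟨a, _ | _⟩
    · exact ⟨-1, by norm_num, by simp [signed]⟩
    · exact ⟨1, by norm_num, by simp [signed]⟩
  obtain ⟨r, hr, hx⟩ := hs x
  obtain ⟨s, hs', hy⟩ := hs y
  obtain ⟨t, ht, hz⟩ := hs z
  have : tdet (signed v x) (signed v y) (signed v z) =
      r * s * t * tdet (v x.1) (v y.1) (v z.1) := by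
    rw [hx, hy, hz]; simp [tdet]; ring
  rw [this]
  positivity

lemma IsGeneric.relabel {α β : Type*} {v : β → E3} (h : IsGeneric v) (f : α → β)
    (hf : Function.Injective f) (ε : α → Bool) : IsGeneric fun a => signed v (f a, ε a) :=
  fun _ _ _ hij hjk hik => tdet_signed_ne_zero _ _ _ (h _ _ _ (hf.ne hij) (hf.ne hjk) (hf.ne hik))

theorem hasProjFan_of_isPentagon {v : Fin 6 → E3} (hv : IsGeneric v)
    (h : IsPentagon (v 0) (v 1) (v 2) (v 3) (v 4)) : HasProjFan v := by
  obtain ⟨c, ⟨hc, t, ht, hct⟩, hx⟩ := (isFan_pentagonFan h).exists_coord (v 5)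
  have hdist : ∀ q ∈ pentagonTriangles, q.1.1 ≠ q.2.1.1 ∧ q.2.1.1 ≠ q.2.2.1 ∧ q.1.1 ≠ q.2.2.1 ∧
      q.1.1 ≠ 5 ∧ q.2.1.1 ≠ 5 ∧ q.2.2.1 ≠ 5 := by decide +kernel
  -- Changing the sign of the sixth vector exchanges antipodal triangles.
  have key : ∀ (b : Bool) (x y z : Fin 6 × Bool) (r s t : ℝ), (x, y, z) ∈ pentagonTriangles →
      0 ≤ r → 0 ≤ s → 0 ≤ t →
      signed v (5, b) = r • signed v x + s • signed v y + t • signed v z → HasProjFan v := by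
    intro b x y z r s t hq hr hs ht h5
    obtain ⟨hxy, hyz, hxz, hx5, hy5, hz5⟩ := hdist _ hq
    have hne : ∀ (i j k : Fin 6 × Bool) (r s t : ℝ), j.1 ≠ k.1 → j.1 ≠ 5 → k.1 ≠ 5 →
        signed v (5, b) = r • signed v i + s • signed v j + t • signed v k → r ≠ 0 := by
      rintro i j k r s t hjk hj hk h5 rfl
      refine tdet_signed_ne_zero (v := v) (5, b) j k (hv _ _ _ hj.symm hjk hk.symm) ?_
      rw [h5, tdet_comb_left, tdet_self_left, tdet_self_outer]
      ring
    have hr' := hr.lt_of_ne' (hne x y z r s t hyz hy5 hz5 h5)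
    have hs' := hs.lt_of_ne' (hne y x z s r t hxz hx5 hz5 (by rw [h5]; abel))
    have ht' := ht.lt_of_ne' (hne z x y t r s hxy hx5 hy5 (by rw [h5]; abel))
    refine .of_relabel id Function.injective_id (fun a => if a = 5 then b else true)
      (hasProjFan_of_mem_triangle (x := x) (y := y) (z := z) ?_ hq hr' hs' ht' ?_)
    · exact h
    · have hsg : ∀ i : Fin 6 × Bool, i.1 ≠ 5 → signed (fun a => signed v (id a,
          if a = 5 then b else true)) i = signed v i := by
        rintro ⟨i, e⟩ hi
        have hi' : i ≠ 5 := hi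
        cases e <;> simp [signed, hi']
      rw [hsg x hx5, hsg y hy5, hsg z hz5, ← h5]
      rfl
  have hsum : ∀ x y z : Fin 6 × Bool, t = {x, y, z} → x.1 ≠ y.1 → y.1 ≠ z.1 → x.1 ≠ z.1 →
      v 5 = c x • signed v x + c y • signed v y + c z • signed v z := by
    intro x y z ht hxy hyz hxz
    rw [← hx, ← Finset.sum_subset (Finset.subset_univ t) (fun i _ hi => by rw [hct i hi, zero_smul]),
      ht, Finset.sum_insert, Finset.sum_insert, Finset.sum_singleton, add_assoc]
    · simp only [Finset.mem_singleton]; exact fun hh => hyz (by rw [hh])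
    · simp only [Finset.mem_insert, Finset.mem_singleton, not_or]
      exact ⟨fun hh => hxy (by rw [hh]), fun hh => hxz (by rw [hh])⟩
  simp only [pentagonFan, Finset.mem_union, List.mem_toFinset, List.mem_map] at ht
  rcases ht with ⟨⟨x, y, z⟩, hq, ht⟩ | ⟨⟨x, y, z⟩, hq, ht⟩
  · obtain ⟨hxy, hyz, hxz, -⟩ := hdist _ hq
    exact key true x y z _ _ _ hq (hc _) (hc _) (hc _) (hsum x y z ht.symm hxy hyz hxz)
  · obtain ⟨hxy, hyz, hxz, -⟩ := hdist _ hq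
    refine key false x y z _ _ _ hq (hc (opp x)) (hc (opp y)) (hc (opp z)) ?_
    have := hsum (opp x) (opp y) (opp z) ht.symm hxy hyz hxz
    simp only [signed_opp] at this
    change -v 5 = _
    rw [this]
    module

/-! ### Five points in general position span a convex pentagon -/

/-- The linear map with columns `a`, `b` and `c`. -/
def comb (a b c x : E3) : E3 := x 0 • a + x 1 • b + x 2 • c

lemma tdet_comb (a b c x y z : E3) :
    tdet (comb a b c x) (comb a b c y) (comb a b c z) = tdet x y z * tdet a b c := by
  simp [tdet, comb]; ring

lemma IsPentagon.comb {x₀ x₁ x₂ x₃ x₄ : E3} (h : IsPentagon x₀ x₁ x₂ x₃ x₄) {a b c : E3}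
    (hD : 0 < tdet a b c) : IsPentagon (comb a b c x₀) (comb a b c x₁) (comb a b c x₂)
      (comb a b c x₃) (comb a b c x₄) := by
  constructor <;> rw [tdet_comb]
  exacts [mul_pos h.abc hD, mul_pos h.abd hD, mul_pos h.abe hD, mul_pos h.acd hD, mul_pos h.ace hD,
    mul_pos h.ade hD, mul_pos h.bcd hD, mul_pos h.bce hD, mul_pos h.bde hD, mul_pos h.cde hD]

/-- The slopes `eᵢ / dᵢ`, together with `0` for the fourth and `∞` for the fifth vector, are the
slopes of the Gale dual of the five vectors. Their cyclic order is the order of the vertices of a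
convex pentagon, for suitable signs of the vectors. -/
lemma hasProjFan_of_sorted_of_pos {v : Fin 6 → E3} (hv : IsGeneric v) {d₀ d₁ d₂ e₀ e₁ e₂ : ℝ}
    (h₀ : 0 < d₀) (h₁ : 0 < d₁) (h₂ : 0 < d₂) (h01 : e₀ * d₁ < e₁ * d₀) (h12 : e₁ * d₂ < e₂ * d₁)
    (h3 : v 3 = d₀ • v 0 + d₁ • v 1 + d₂ • v 2) (h4 : v 4 = e₀ • v 0 + e₁ • v 1 + e₂ • v 2)
    (hD : 0 < tdet (v 0) (v 1) (v 2)) : HasProjFan v := by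
  have h02 : e₀ * d₂ < e₂ * d₀ := by
    have : d₁ * (e₀ * d₂) < d₁ * (e₂ * d₀) := by nlinarith
    exact lt_of_mul_lt_mul_left this h₁.le
  have hne : e₀ ≠ 0 ∧ e₁ ≠ 0 ∧ e₂ ≠ 0 := by
    have t0 := hv 4 1 2 (by decide) (by decide) (by decide)
    have t1 := hv 4 2 0 (by decide) (by decide) (by decide)
    have t2 := hv 4 0 1 (by decide) (by decide) (by decide)
    rw [h4, tdet_comb_left] at t0 t1 t2
    refine ⟨?_, ?_, ?_⟩ <;> rintro rfl
    · simp [tdet_self_left, tdet_self_outer] at t0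
    · simp [tdet_self_left, tdet_self_outer] at t1
    · simp [tdet_self_left, tdet_self_outer] at t2
  have hup : ∀ {d e d' e' : ℝ}, 0 < d → 0 < d' → e * d' < e' * d → 0 < e → 0 < e' := by
    intro d e d' e' hd hd' hlt he
    by_contra! hcon
    linarith [mul_pos he hd', mul_nonpos_of_nonpos_of_nonneg hcon hd.le]
  have hord : 0 < e₀ ∨ (e₀ < 0 ∧ 0 < e₁) ∨ (e₁ < 0 ∧ 0 < e₂) ∨ e₂ < 0 := by
    rcases hne.1.lt_or_gt with h | h
    · rcases hne.2.1.lt_or_gt with h' | h'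
      · rcases hne.2.2.lt_or_gt with h'' | h''
        · exact Or.inr (Or.inr (Or.inr h''))
        · exact Or.inr (Or.inr (Or.inl ⟨h', h''⟩))
      · exact Or.inr (Or.inl ⟨h, h'⟩)
    · exact Or.inl h
  have hdown : ∀ {d e d' e' : ℝ}, 0 < d → 0 < d' → e * d' < e' * d → e' < 0 → e < 0 := by
    intro d e d' e' hd hd' hlt he
    by_contra! hcon
    linarith [mul_nonneg hcon hd'.le, mul_neg_of_neg_of_pos he hd]
  rcases hord with h | ⟨h, h'⟩ | ⟨h, h'⟩ | h
  · have hp1 := hup h₀ h₁ h01 h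
    have hp2 := hup h₁ h₂ h12 hp1
    have hP : IsPentagon !₂[-e₀, -e₁, -e₂] !₂[-d₀, -d₁, -d₂] !₂[-1, 0, 0] !₂[0, 1, 0]
        !₂[0, 0, -1] := by
      constructor <;> simp [tdet] <;> linarith
    refine .of_relabel ![4, 3, 0, 1, 2, 5] (by decide) ![false, false, false, true, false, true]
      (hasProjFan_of_isPentagon (hv.relabel _ (by decide) _) ?_)
    convert hP.comb hD using 1 <;> simp [signed, ProjTri.comb, h3, h4] <;> module
  · have hp2 := hup h₁ h₂ h12 h'
    have hP : IsPentagon !₂[e₀, e₁, e₂] !₂[-1, 0, 0] !₂[-d₀, -d₁, -d₂] !₂[0, -1, 0]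
        !₂[0, 0, 1] := by
      constructor <;> simp [tdet] <;> linarith
    refine .of_relabel ![4, 0, 3, 1, 2, 5] (by decide) ![true, false, false, false, true, true]
      (hasProjFan_of_isPentagon (hv.relabel _ (by decide) _) ?_)
    convert hP.comb hD using 1 <;> simp [signed, ProjTri.comb, h3, h4]
    module
  · have hp0 := hdown h₀ h₁ h01 h
    have hP : IsPentagon !₂[-e₀, -e₁, -e₂] !₂[1, 0, 0] !₂[0, -1, 0] !₂[-d₀, -d₁, -d₂]
        !₂[0, 0, -1] := by
      constructor <;> simp [tdet] <;> linarith
    refine .of_relabel ![4, 0, 1, 3, 2, 5] (by decide) ![false, true, false, false, false, true]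
      (hasProjFan_of_isPentagon (hv.relabel _ (by decide) _) ?_)
    convert hP.comb hD using 1 <;> simp [signed, ProjTri.comb, h3, h4] <;> module
  · have hp1 := hdown h₁ h₂ h12 h
    have hp0 := hdown h₀ h₁ h01 hp1
    have hP : IsPentagon !₂[e₀, e₁, e₂] !₂[-1, 0, 0] !₂[0, 1, 0] !₂[0, 0, -1]
        !₂[-d₀, -d₁, -d₂] := by
      constructor <;> simp [tdet] <;> linarith
    refine .of_relabel ![4, 0, 1, 2, 3, 5] (by decide) ![true, false, true, false, false, true]
      (hasProjFan_of_isPentagon (hv.relabel _ (by decide) _) ?_)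
    convert hP.comb hD using 1 <;> simp [signed, ProjTri.comb, h3, h4]
    module

lemma hasProjFan_of_sorted {v : Fin 6 → E3} (hv : IsGeneric v) {d₀ d₁ d₂ e₀ e₁ e₂ : ℝ}
    (h₀ : 0 < d₀) (h₁ : 0 < d₁) (h₂ : 0 < d₂) (h01 : e₀ * d₁ < e₁ * d₀) (h12 : e₁ * d₂ < e₂ * d₁)
    (h3 : v 3 = d₀ • v 0 + d₁ • v 1 + d₂ • v 2) (h4 : v 4 = e₀ • v 0 + e₁ • v 1 + e₂ • v 2) :
    HasProjFan v := by
  rcases (hv 0 1 2 (by decide) (by decide) (by decide)).lt_or_gt with h | h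
  · refine .of_relabel id Function.injective_id (fun _ => false)
      (hasProjFan_of_sorted_of_pos (hv.relabel _ Function.injective_id _) h₀ h₁ h₂ h01 h12 ?_ ?_ ?_)
    · simp [signed, h3]; abel
    · simp [signed, h4]; abel
    · have : tdet (-v 0) (-v 1) (-v 2) = -tdet (v 0) (v 1) (v 2) := by simp [tdet]; ring
      simpa [signed, this] using h
  · exact hasProjFan_of_sorted_of_pos hv h₀ h₁ h₂ h01 h12 h3 h4 h

/-- The fourth point lies in the cone of the first three, which are sorted by their slopes. The
slopes are distinct because no three of the five points are collinear. -/
lemma hasProjFan_of_pos {v : Fin 6 → E3} (hv : IsGeneric v) {d₀ d₁ d₂ e₀ e₁ e₂ : ℝ}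
    (h₀ : 0 < d₀) (h₁ : 0 < d₁) (h₂ : 0 < d₂)
    (h3 : v 3 = d₀ • v 0 + d₁ • v 1 + d₂ • v 2) (h4 : v 4 = e₀ • v 0 + e₁ • v 1 + e₂ • v 2) :
    HasProjFan v := by
  have hcross : ∀ r s t x y z : ℝ, tdet (r • v 0 + s • v 1 + t • v 2)
      (x • v 0 + y • v 1 + z • v 2) (v 2) = (r * y - s * x) * tdet (v 0) (v 1) (v 2) := by
    intros; simp [tdet]; ring
  have hcross' : ∀ r s t x y z : ℝ, tdet (r • v 0 + s • v 1 + t • v 2)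
      (x • v 0 + y • v 1 + z • v 2) (v 0) = (s * z - t * y) * tdet (v 0) (v 1) (v 2) := by
    intros; simp [tdet]; ring
  have hcross'' : ∀ r s t x y z : ℝ, tdet (r • v 0 + s • v 1 + t • v 2)
      (x • v 0 + y • v 1 + z • v 2) (v 1) = (t * x - r * z) * tdet (v 0) (v 1) (v 2) := by
    intros; simp [tdet]; ring
  have n01 : e₀ * d₁ ≠ e₁ * d₀ := by
    have := hv 4 3 2 (by decide) (by decide) (by decide)
    rw [h3, h4, hcross] at this
    exact fun hh => this (by rw [hh]; ring)
  have n12 : e₁ * d₂ ≠ e₂ * d₁ := by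
    have := hv 4 3 0 (by decide) (by decide) (by decide)
    rw [h3, h4, hcross'] at this
    exact fun hh => this (by rw [hh]; ring)
  have n02 : e₀ * d₂ ≠ e₂ * d₀ := by
    have := hv 4 3 1 (by decide) (by decide) (by decide)
    rw [h3, h4, hcross''] at this
    exact fun hh => this (by rw [hh]; ring)
  rcases n01.lt_or_gt with h01 | h01 <;> rcases n12.lt_or_gt with h12 | h12 <;>
    rcases n02.lt_or_gt with h02 | h02
  · exact hasProjFan_of_sorted hv h₀ h₁ h₂ h01 h12 h3 h4
  · exact hasProjFan_of_sorted hv h₀ h₁ h₂ h01 h12 h3 h4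
  · exact .of_relabel ![0, 2, 1, 3, 4, 5] (by decide) (fun _ => true)
      (hasProjFan_of_sorted (hv.relabel _ (by decide) _) h₀ h₂ h₁ h02 h12
        (h3.trans (by simp [signed]; abel)) (h4.trans (by simp [signed]; abel)))
  · exact .of_relabel ![2, 0, 1, 3, 4, 5] (by decide) (fun _ => true)
      (hasProjFan_of_sorted (hv.relabel _ (by decide) _) h₂ h₀ h₁ h02 h01
        (h3.trans (by simp [signed]; abel)) (h4.trans (by simp [signed]; abel)))
  · exact .of_relabel ![1, 0, 2, 3, 4, 5] (by decide) (fun _ => true)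
      (hasProjFan_of_sorted (hv.relabel _ (by decide) _) h₁ h₀ h₂ h01 h02
        (h3.trans (by simp [signed]; abel)) (h4.trans (by simp [signed]; abel)))
  · exact .of_relabel ![1, 2, 0, 3, 4, 5] (by decide) (fun _ => true)
      (hasProjFan_of_sorted (hv.relabel _ (by decide) _) h₁ h₂ h₀ h12 h02
        (h3.trans (by simp [signed]; abel)) (h4.trans (by simp [signed]; abel)))
  · exact .of_relabel ![2, 1, 0, 3, 4, 5] (by decide) (fun _ => true)
      (hasProjFan_of_sorted (hv.relabel _ (by decide) _) h₂ h₁ h₀ h12 h01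
        (h3.trans (by simp [signed]; abel)) (h4.trans (by simp [signed]; abel)))
  · exact .of_relabel ![2, 1, 0, 3, 4, 5] (by decide) (fun _ => true)
      (hasProjFan_of_sorted (hv.relabel _ (by decide) _) h₂ h₁ h₀ h12 h01
        (h3.trans (by simp [signed]; abel)) (h4.trans (by simp [signed]; abel)))

/-- Any six points in general position are the vertices of a triangulation of the projective
plane. -/
theorem hasProjFan_of_isGeneric {v : Fin 6 → E3} (hv : IsGeneric v) : HasProjFan v := by
  have h012 := hv 0 1 2 (by decide) (by decide) (by decide)
  obtain ⟨d₀, d₁, d₂, h3⟩ := exists_comb h012 (v 3)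
  obtain ⟨e₀, e₁, e₂, h4⟩ := exists_comb h012 (v 4)
  have hne : d₀ ≠ 0 ∧ d₁ ≠ 0 ∧ d₂ ≠ 0 := by
    have t0 := hv 3 1 2 (by decide) (by decide) (by decide)
    have t1 := hv 3 2 0 (by decide) (by decide) (by decide)
    have t2 := hv 3 0 1 (by decide) (by decide) (by decide)
    rw [h3, tdet_comb_left] at t0 t1 t2
    refine ⟨?_, ?_, ?_⟩ <;> rintro rfl
    · simp [tdet_self_left, tdet_self_outer] at t0
    · simp [tdet_self_left, tdet_self_outer] at t1
    · simp [tdet_self_left, tdet_self_outer] at t2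
  -- The signs of the first three vectors are chosen such that the fourth lies in their cone.
  have hs : ∀ d : ℝ, d ≠ 0 → ∃ (b : Bool), 0 < (if b then d else -d) := by
    intro d hd
    rcases hd.lt_or_gt with h | h
    · exact ⟨false, by simpa using h⟩
    · exact ⟨true, by simpa using h⟩
  obtain ⟨b₀, hb₀⟩ := hs d₀ hne.1
  obtain ⟨b₁, hb₁⟩ := hs d₁ hne.2.1
  obtain ⟨b₂, hb₂⟩ := hs d₂ hne.2.2
  have hsm : ∀ (b : Bool) (d : ℝ) (i : Fin 6), (if b then d else -d) • signed v (i, b) = d • v i := by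
    intro b d i
    cases b <;> simp [signed]
  refine .of_relabel id Function.injective_id ![b₀, b₁, b₂, true, true, true]
    (hasProjFan_of_pos (hv.relabel _ Function.injective_id _) hb₀ hb₁ hb₂
      (e₀ := if b₀ then e₀ else -e₀) (e₁ := if b₁ then e₁ else -e₁)
      (e₂ := if b₂ then e₂ else -e₂) ?_ ?_)
  · refine Eq.trans h3 ?_
    rw [← hsm b₀, ← hsm b₁, ← hsm b₂]
    rfl
  · refine Eq.trans h4 ?_
    rw [← hsm b₀, ← hsm b₁, ← hsm b₂]
    rfl

/-! ### The topology of the projective plane -/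

lemma continuous_mk' : Continuous (Projectivization.mk' ℝ : {v : E3 // v ≠ 0} → P2) :=
  continuous_coinduced_rng

/-- The squared cosine of the angle between `v` and a line separates the line spanned by `v` from
all other lines. -/
instance instT2SpaceP2 : T2Space P2 := by
  refine ⟨fun a b hab => ?_⟩
  induction a using Projectivization.ind with | h v hv =>
  induction b using Projectivization.ind with | h w hw =>
  have hinv : ∀ x y : {v : E3 // v ≠ 0}, ∀ r : ℝ, (x : E3) = r • (y : E3) →
      (inner ℝ v (x : E3)) ^ 2 / (‖v‖ ^ 2 * ‖(x : E3)‖ ^ 2) =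
        (inner ℝ v (y : E3)) ^ 2 / (‖v‖ ^ 2 * ‖(y : E3)‖ ^ 2) := by
    intro x y r hxy
    have hr : r ≠ 0 := by
      rintro rfl
      exact x.2 (by simpa using hxy)
    have := norm_ne_zero_iff.2 hv
    have := norm_ne_zero_iff.2 y.2
    rw [hxy, inner_smul_right, norm_smul, mul_pow, mul_pow, Real.norm_eq_abs, sq_abs]
    field_simp
  let f : P2 → ℝ := Projectivization.lift
    (fun x : {v : E3 // v ≠ 0} => (inner ℝ v (x : E3)) ^ 2 / (‖v‖ ^ 2 * ‖(x : E3)‖ ^ 2)) hinv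
  have hf : Continuous f := by
    refine continuous_coinduced_dom.2 ?_
    change Continuous fun x : {v : E3 // v ≠ 0} =>
      (inner ℝ v (x : E3)) ^ 2 / (‖v‖ ^ 2 * ‖(x : E3)‖ ^ 2)
    refine Continuous.div (by fun_prop) (by fun_prop) fun x => ?_
    have := norm_ne_zero_iff.2 hv
    have := norm_ne_zero_iff.2 x.2
    positivity
  refine separated_by_continuous hf fun hfab => hab ?_
  have hv' := norm_ne_zero_iff.2 hv
  have hw' := norm_ne_zero_iff.2 hw
  have hfab' : (inner ℝ v v) ^ 2 / (‖v‖ ^ 2 * ‖v‖ ^ 2) =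
      (inner ℝ v w : ℝ) ^ 2 / (‖v‖ ^ 2 * ‖w‖ ^ 2) := hfab
  -- Equality in the Cauchy–Schwarz inequality.
  have habs : ‖inner ℝ v w / (‖v‖ * ‖w‖)‖ = 1 := by
    rw [real_inner_self_eq_norm_sq] at hfab'
    rw [Real.norm_eq_abs, ← sq_eq_sq₀ (abs_nonneg _) zero_le_one, sq_abs, div_pow, mul_pow, ← hfab']
    field_simp
  obtain ⟨-, r, hr, hwv⟩ := (abs_real_inner_div_norm_mul_norm_eq_one_iff v w).1 habs
  rw [Projectivization.mk_eq_mk_iff']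
  exact ⟨r⁻¹, by rw [hwv, inv_smul_smul₀ hr]⟩

lemma exists_proj_eq (a : P2) : ∃ x : S2, proj x = a := by
  induction a using Projectivization.ind with | h v hv =>
  have hn := norm_ne_zero_iff.2 hv
  refine ⟨⟨‖v‖⁻¹ • v, by simp [norm_smul, hn]⟩, ?_⟩
  rw [proj, Projectivization.mk_eq_mk_iff']
  exact ⟨‖v‖⁻¹, rfl⟩

/-- The projective point of the normalization of a nonzero vector. -/
lemma exists_proj_eq_mk {w : E3} (hw : w ≠ 0) :
    ∃ x : S2, (x : E3) = ‖w‖⁻¹ • w ∧ proj x = Projectivization.mk ℝ w hw := by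
  have hn := norm_ne_zero_iff.2 hw
  refine ⟨⟨‖w‖⁻¹ • w, by simp [norm_smul, hn]⟩, rfl, ?_⟩
  rw [proj, Projectivization.mk_eq_mk_iff']
  exact ⟨‖w‖⁻¹, rfl⟩

theorem tdet_ne_zero_of_not_isCollinear {x y z : S2}
    (h : ¬ Projectivization.IsCollinear ({proj x, proj y, proj z} : Set P2)) :
    tdet x y z ≠ 0 := by
  intro h0
  apply h
  have hdep : ¬ LinearIndependent ℝ ![(x : E3), y, z] := by
    intro hli
    have hM : IsUnit (Matrix.of ![(x : E3).ofLp, (y : E3).ofLp, (z : E3).ofLp]) := by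
      rw [← Matrix.linearIndependent_rows_iff_isUnit]
      have := hli.map' (WithLp.linearEquiv 2 ℝ (Fin 3 → ℝ)).toLinearMap (by simp)
      have hrow : (Matrix.of ![(x : E3).ofLp, (y : E3).ofLp, (z : E3).ofLp]).row =
          (WithLp.linearEquiv 2 ℝ (Fin 3 → ℝ)) ∘ ![(x : E3), y, z] := by
        ext i j
        fin_cases i <;> rfl
      rw [hrow]
      exact this
    rw [Matrix.isUnit_iff_isUnit_det, Matrix.det_fin_three] at hM
    refine hM.ne_zero ?_
    simp [tdet] at h0 ⊢
    linarith
  refine ⟨(Submodule.span ℝ (Set.range ![(x : E3), y, z])).projectivization, ?_, ?_, ?_⟩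
  · rw [Projectivization.Subspace.submodule.apply_symm_apply]
    infer_instance
  · rw [Projectivization.Subspace.submodule.apply_symm_apply]
    rw [linearIndependent_iff_card_le_finrank_span] at hdep
    have : Set.finrank ℝ (Set.range ![(x : E3), y, z]) < 3 := by simpa using hdep
    exact Nat.le_of_lt_succ this
  · rintro _ (rfl | rfl | rfl)
    · exact (Submodule.mk_mem_projectivization_iff _ _).2 (Submodule.subset_span ⟨0, rfl⟩)
    · exact (Submodule.mk_mem_projectivization_iff _ _).2 (Submodule.subset_span ⟨1, rfl⟩)
    · exact (Submodule.mk_mem_projectivization_iff _ _).2 (Submodule.subset_span ⟨2, rfl⟩)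

/-! ### From projective fans to projective triangulations -/

theorem IsFan.linearIndependent {ι : Type*} [Fintype ι] [DecidableEq ι] {u : ι → E3}
    {T : Finset (Finset ι)} (h : IsFan u T) {t : Finset ι} (ht : t ∈ T) :
    LinearIndependent ℝ fun i : t => u i := by
  rw [Fintype.linearIndependent_iff]
  intro g hg
  set G : ι → ℝ := fun i => if hi : i ∈ t then g ⟨i, hi⟩ else 0 with hG
  have hsum : ∑ i, G i • u i = 0 := by
    rw [← hg, ← Finset.sum_subset (Finset.subset_univ t) (fun i _ hi => by simp [hG, hi]),
      ← Finset.sum_coe_sort t]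
    refine Finset.sum_congr rfl fun i _ => ?_
    simp [hG]
  -- The positive and the negative part of a linear relation are two expansions of one vector.
  have key := h.unique (fun i => max (G i) 0) (fun i => max (-G i) 0)
    ⟨fun i => le_max_right _ _, t, ht, fun i hi => by simp [hG, hi]⟩
    ⟨fun i => le_max_right _ _, t, ht, fun i hi => by simp [hG, hi]⟩ (by
      rw [← sub_eq_zero, ← Finset.sum_sub_distrib, ← hsum]
      refine Finset.sum_congr rfl fun i _ => ?_
      rw [← sub_smul]
      congr 1
      rcases le_total 0 (G i) with h | h
      · rw [max_eq_left h, max_eq_right (by linarith)]; ring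
      · rw [max_eq_right h, max_eq_left (by linarith)]; ring)
  intro i
  have h1 : max (G i) 0 = max (-G i) 0 := congrFun key i
  have h2 : G i = g i := by simp [hG]
  rw [← h2]
  rcases le_total 0 (G i) with h | h
  · rw [max_eq_left h, max_eq_right (by linarith)] at h1; exact h1
  · rw [max_eq_right h, max_eq_left (by linarith)] at h1; linarith

section Chart

variable {α : Type*}

/-- The vertices of a signed simplex. -/
def base [DecidableEq α] (t : Finset (α × Bool)) : Finset α := t.image Prod.fst

lemma exists_mem_of_mem_base [DecidableEq α] {t : Finset (α × Bool)} {a : α} (h : a ∈ base t) :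
    ∃ i ∈ t, i.1 = a := by
  simpa only [base, Finset.mem_image] using h

lemma fst_mem_base [DecidableEq α] {t : Finset (α × Bool)} {i : α × Bool} (h : i ∈ t) :
    i.1 ∈ base t :=
  Finset.mem_image_of_mem _ h

lemma base_image_opp [DecidableEq α] (t : Finset (α × Bool)) : base (t.image opp) = base t := by
  rw [base, Finset.image_image]
  rfl

lemma closedSimplex_mono [Fintype α] {s t : Finset α} (hst : s ⊆ t) :
    closedSimplex s ⊆ closedSimplex t :=
  fun _ hx => ⟨hx.1, fun a ha => hx.2 a fun has => ha (hst has)⟩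

lemma exists_ne_zero_of_mem_closedSimplex [Fintype α] {s : Finset α} {x : α → ℝ}
    (hx : x ∈ closedSimplex s) : ∃ a ∈ s, x a ≠ 0 := by
  by_contra! hcon
  have h0 : ∀ a, x a = 0 := fun a => by
    by_cases ha : a ∈ s
    · exact hcon a ha
    · exact hx.2 a ha
  have := hx.1.2
  simp [h0] at this

lemma isCompact_closedSimplex [Fintype α] (s : Finset α) : IsCompact (closedSimplex s) := by
  have : closedSimplex s = stdSimplex ℝ α ∩ ⋂ a, ⋂ (_ : a ∉ s), {x : α → ℝ | x a = 0} := by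
    ext x
    simp [closedSimplex]
  rw [this]
  exact (isCompact_stdSimplex ℝ α).inter_right (isClosed_iInter fun a => isClosed_iInter fun _ =>
    isClosed_eq (continuous_apply a) continuous_const)

variable [Fintype α] [DecidableEq α]

/-- The barycentric coordinates `x` on the vertices of the signed simplex `t`. -/
noncomputable def liftCoord (t : Finset (α × Bool)) (x : α → ℝ) (i : α × Bool) : ℝ :=
  if i ∈ t then x i.1 else 0

/-- The linear chart of the signed simplex `t`. -/
noncomputable def chart (v : α → E3) (t : Finset (α × Bool)) (x : α → ℝ) : E3 :=
  ∑ i, liftCoord t x i • signed v i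

lemma chart_image_opp (v : α → E3) (t : Finset (α × Bool)) (x : α → ℝ) :
    chart v (t.image opp) x = -chart v t x := by
  rw [chart, chart, ← Finset.sum_neg_distrib]
  refine Finset.sum_bijective opp opp_injective.bijective_of_finite (by simp) fun i _ => ?_
  simp only [liftCoord, mem_image_opp, opp_fst, signed_opp, smul_neg, neg_neg]

lemma continuous_chart (v : α → E3) (t : Finset (α × Bool)) : Continuous (chart v t) := by
  refine continuous_finsetSum _ fun i _ => Continuous.fun_smul ?_ continuous_const
  unfold liftCoord
  split_ifs <;> fun_prop

variable {v : α → E3} {Q : Finset α} {T : Finset (Finset (α × Bool))}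

lemma IsProjFan.opp_notMem (h : IsProjFan v Q T) {t : Finset (α × Bool)} (ht : t ∈ T)
    {i : α × Bool} (hi : i ∈ t) : opp i ∉ t :=
  h.simple t ht t ht i hi hi i hi

lemma IsProjFan.eq_of_fst_eq (h : IsProjFan v Q T) {t : Finset (α × Bool)} (ht : t ∈ T)
    {i j : α × Bool} (hi : i ∈ t) (hj : j ∈ t) (hij : i.1 = j.1) : i = j := by
  rcases eq_or_eq_opp hij with h1 | h1
  · exact h1
  · exact absurd (h1 ▸ hi) (h.opp_notMem ht hj)

lemma IsProjFan.card_base (h : IsProjFan v Q T) {t : Finset (α × Bool)} (ht : t ∈ T) :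
    (base t).card = 3 := by
  rw [base, Finset.card_image_of_injOn, h.card t ht]
  exact fun i hi j hj hij => h.eq_of_fst_eq ht hi hj hij

lemma isCoord_liftCoord {t : Finset (α × Bool)} (ht : t ∈ T) {x : α → ℝ}
    (hx : x ∈ closedSimplex (base t)) : IsCoord T (liftCoord t x) := by
  refine ⟨fun i => ?_, t, ht, fun i hi => if_neg hi⟩
  unfold liftCoord
  split_ifs
  · exact hx.1.1 _
  · exact le_rfl

lemma IsProjFan.chart_ne_zero (h : IsProjFan v Q T) {t : Finset (α × Bool)} (ht : t ∈ T)
    {x : α → ℝ} (hx : x ∈ closedSimplex (base t)) : chart v t x ≠ 0 := by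
  intro h0
  have key := h.fan.unique _ 0 (isCoord_liftCoord ht hx)
    ⟨fun _ => le_rfl, t, ht, fun _ _ => rfl⟩ (by simpa [chart] using h0)
  obtain ⟨a, ha, hxa⟩ := exists_ne_zero_of_mem_closedSimplex hx
  obtain ⟨i, hi, rfl⟩ := exists_mem_of_mem_base ha
  have := congrFun key i
  simp only [liftCoord, if_pos hi, Pi.zero_apply] at this
  exact hxa this

/-- The charts of two signed simplices agree up to sign on the intersection of their domains. -/
lemma IsProjFan.chart_eq_or_eq_neg (h : IsProjFan v Q T) {s t : Finset (α × Bool)} (hs : s ∈ T)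
    (ht : t ∈ T) {x : α → ℝ} (hxs : x ∈ closedSimplex (base s))
    (hxt : x ∈ closedSimplex (base t)) : chart v s x = chart v t x ∨ chart v s x = -chart v t x := by
  have key : ∀ t ∈ T, x ∈ closedSimplex (base t) → ∀ i ∈ s, i ∈ t →
      chart v s x = chart v t x := by
    intro t ht hxt i his hit
    refine Finset.sum_congr rfl fun k _ => ?_
    congr 1
    unfold liftCoord
    by_cases hk : x k.1 = 0
    · simp [hk]
    have hiff : k ∈ s ↔ k ∈ t := by
      constructor
      · intro hks
        obtain ⟨j, hj, hjk⟩ := exists_mem_of_mem_base (by_contra fun hh => hk (hxt.2 k.1 hh))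
        rcases eq_or_eq_opp hjk with rfl | rfl
        · exact hj
        · exact absurd hj (h.simple s hs t ht i his hit k hks)
      · intro hkt
        obtain ⟨j, hj, hjk⟩ := exists_mem_of_mem_base (by_contra fun hh => hk (hxs.2 k.1 hh))
        rcases eq_or_eq_opp hjk with rfl | rfl
        · exact hj
        · exact absurd hj (h.simple t ht s hs i hit his k hkt)
    simp [hiff]
  obtain ⟨a, ha, hxa⟩ := exists_ne_zero_of_mem_closedSimplex hxs
  obtain ⟨i, hi, rfl⟩ := exists_mem_of_mem_base ha
  obtain ⟨j, hj, hji⟩ := exists_mem_of_mem_base (by_contra fun hh => hxa (hxt.2 i.1 hh))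
  rcases eq_or_eq_opp hji with rfl | rfl
  · exact Or.inl (key t ht hxt j hi hj)
  · refine Or.inr ?_
    rw [← chart_image_opp]
    exact key _ (h.symm t ht) (by rwa [base_image_opp]) i hi (mem_image_opp.2 hj)

lemma IsProjFan.eq_of_chart_eq_smul (h : IsProjFan v Q T) {s t : Finset (α × Bool)} (hs : s ∈ T)
    (ht : t ∈ T) {x y : α → ℝ} (hx : x ∈ closedSimplex (base s))
    (hy : y ∈ closedSimplex (base t)) {r : ℝ} (hxy : chart v s x = r • chart v t y) : x = y := by
  have key : ∀ t ∈ T, y ∈ closedSimplex (base t) → ∀ r : ℝ, 0 < r →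
      chart v s x = r • chart v t y → x = y := by
    intro t ht hy r hr hxy
    have hl := h.fan.unique (liftCoord s x) (fun i => r * liftCoord t y i)
      (isCoord_liftCoord hs hx) (by
        obtain ⟨h1, -⟩ := isCoord_liftCoord ht hy
        exact ⟨fun i => mul_nonneg hr.le (h1 i), t, ht, fun i hi => by simp [liftCoord, hi]⟩) (by
        rw [chart, chart, Finset.smul_sum] at hxy
        simpa only [mul_smul] using hxy)
    have hxr : ∀ a, x a = r * y a := by
      intro a
      by_cases hxa : x a = 0
      · by_cases hya : y a = 0
        · rw [hxa, hya, mul_zero]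
        · obtain ⟨i, hi, rfl⟩ := exists_mem_of_mem_base (by_contra fun hh => hya (hy.2 a hh))
          have := congrFun hl i
          simp only [liftCoord, if_pos hi] at this
          rw [← this, hxa, ite_self]
      · obtain ⟨i, hi, rfl⟩ := exists_mem_of_mem_base (by_contra fun hh => hxa (hx.2 a hh))
        have := congrFun hl i
        simp only [liftCoord, if_pos hi] at this
        by_cases hit : i ∈ t
        · rwa [if_pos hit] at this
        · rw [if_neg hit, mul_zero] at this
          exact absurd this hxa
    have hr1 : r = 1 := by
      have h1 := hx.1.2
      simp only [hxr, ← Finset.mul_sum, hy.1.2, mul_one] at h1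
      exact h1
    funext a
    rw [hxr a, hr1, one_mul]
  rcases lt_trichotomy r 0 with hr | hr | hr
  · exact key _ (h.symm t ht) (by rwa [base_image_opp]) (-r) (neg_pos.2 hr)
      (by rw [chart_image_opp, hxy, smul_neg, neg_smul, neg_neg])
  · exact absurd (by rw [hxy, hr, zero_smul]) (h.chart_ne_zero hs hx)
  · exact key t ht hy r hr hxy

lemma IsProjFan.exists_chart_eq_smul (h : IsProjFan v Q T) {w : E3} (hw : w ≠ 0) :
    ∃ t ∈ T, ∃ x ∈ closedSimplex (base t), ∃ r : ℝ, chart v t x = r • w := by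
  obtain ⟨c, ⟨hc, t, ht, hct⟩, hcw⟩ := h.fan.exists_coord w
  have hpos : 0 < ∑ i, c i := by
    refine (Finset.sum_nonneg fun i _ => hc i).lt_of_ne' fun h0 => hw ?_
    rw [Finset.sum_eq_zero_iff_of_nonneg fun i _ => hc i] at h0
    rw [← hcw]
    exact Finset.sum_eq_zero fun i hi => by rw [h0 i hi, zero_smul]
  refine ⟨t, ht, fun a => (∑ i, c i)⁻¹ * (c (a, true) + c (a, false)), ⟨⟨fun a => ?_, ?_⟩,
    fun a ha => ?_⟩, (∑ i, c i)⁻¹, ?_⟩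
  · exact mul_nonneg (inv_nonneg.2 hpos.le) (add_nonneg (hc _) (hc _))
  · rw [← Finset.mul_sum]
    have : ∑ a, (c (a, true) + c (a, false)) = ∑ i, c i := by
      rw [Fintype.sum_prod_type]
      simp only [Fintype.sum_bool]
    rw [this, inv_mul_cancel₀ hpos.ne']
  · beta_reduce
    rw [hct (a, true) fun hh => ha (fst_mem_base hh), hct (a, false) fun hh => ha (fst_mem_base hh)]
    simp
  · rw [← hcw, chart, Finset.smul_sum]
    refine Finset.sum_congr rfl fun i _ => ?_
    rw [smul_smul]
    congr 1
    unfold liftCoord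
    by_cases hi : i ∈ t
    · have h0 := hct _ (h.opp_notMem ht hi)
      rcases i with ⟨a, _ | _⟩
      · have h0' : c (a, true) = 0 := h0
        simp [hi, h0']
      · have h0' : c (a, false) = 0 := h0
        simp [hi, h0']
    · simp [hi, hct i hi]

/-- The chart of a signed simplex on a face `s`, the lifts of whose vertices are given by `ℓ`. -/
lemma IsProjFan.chart_eq_sum (h : IsProjFan v Q T) {t : Finset (α × Bool)} (ht : t ∈ T)
    {s : Finset α} {ℓ : s → α × Bool} (hℓ : ∀ a, ℓ a ∈ t) (hℓ' : ∀ a, (ℓ a).1 = a) {x : α → ℝ}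
    (hx : ∀ a, a ∉ s → x a = 0) : chart v t x = ∑ a : s, x a • signed v (ℓ a) := by
  have hinj : Function.Injective ℓ := fun a b hab => Subtype.ext (by rw [← hℓ' a, ← hℓ' b, hab])
  have hlift : ∀ a, liftCoord t x (ℓ a) = x a := fun a => by simp [liftCoord, hℓ a, hℓ' a]
  rw [chart, ← Finset.sum_subset (Finset.subset_univ (Finset.univ.image ℓ)),
    Finset.sum_image hinj.injOn]
  · simp only [hlift]
  · intro i _ hi
    have : liftCoord t x i = 0 := by
      unfold liftCoord
      by_cases hit : i ∈ t
      · rw [if_pos hit]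
        refine hx _ fun his => hi ?_
        have : ℓ ⟨i.1, his⟩ = i := h.eq_of_fst_eq ht (hℓ _) hit (hℓ' _)
        rw [← this]
        exact Finset.mem_image_of_mem _ (Finset.mem_univ _)
      · rw [if_neg hit]
    rw [this, zero_smul]

/-- The quotient of a projective fan by the antipodal map, as a simplicial complex. -/
def IsProjFan.complex (h : IsProjFan v Finset.univ T) : AbstractSimplicialComplex α where
  faces := {s | s.Nonempty ∧ ∃ t ∈ T, s ⊆ base t}
  isRelLowerSet_faces := by
    rintro s ⟨hs, t, ht, hst⟩
    exact ⟨hs, fun r hrs hr => ⟨hr, t, ht, hrs.trans hst⟩⟩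
  singleton_mem a := by
    obtain ⟨t, ht, hat⟩ := h.cover a (Finset.mem_univ a)
    exact ⟨Finset.singleton_nonempty a, t, ht,
      Finset.singleton_subset_iff.2 (fst_mem_base hat)⟩

lemma IsProjFan.base_mem_faces (h : IsProjFan v Finset.univ T) {t : Finset (α × Bool)}
    (ht : t ∈ T) : base t ∈ h.complex.faces :=
  ⟨Finset.card_pos.1 (by rw [h.card_base ht]; norm_num), t, ht, subset_rfl⟩

lemma IsProjFan.exists_mem_closedSimplex (h : IsProjFan v Finset.univ T)
    (x : realization h.complex) : ∃ t ∈ T, (x : α → ℝ) ∈ closedSimplex (base t) := by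
  obtain ⟨x, hx⟩ := x
  simp only [realization, Set.mem_iUnion] at hx
  obtain ⟨s, ⟨-, t, ht, hst⟩, hxs⟩ := hx
  exact ⟨t, ht, closedSimplex_mono hst hxs⟩

/-- The map from the realization of the quotient complex to the projective plane that is given by
the charts of the signed simplices. -/
noncomputable def IsProjFan.toP2 (h : IsProjFan v Finset.univ T) (x : realization h.complex) : P2 :=
  Projectivization.mk ℝ (chart v (h.exists_mem_closedSimplex x).choose x)
    (h.chart_ne_zero (h.exists_mem_closedSimplex x).choose_spec.1
      (h.exists_mem_closedSimplex x).choose_spec.2)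

lemma IsProjFan.toP2_eq (h : IsProjFan v Finset.univ T) {t : Finset (α × Bool)} (ht : t ∈ T)
    (x : realization h.complex) (hx : (x : α → ℝ) ∈ closedSimplex (base t)) :
    h.toP2 x = Projectivization.mk ℝ (chart v t x) (h.chart_ne_zero ht hx) := by
  rw [toP2, Projectivization.mk_eq_mk_iff']
  rcases h.chart_eq_or_eq_neg (h.exists_mem_closedSimplex x).choose_spec.1 ht
    (h.exists_mem_closedSimplex x).choose_spec.2 hx with h1 | h1
  · exact ⟨1, by rw [h1, one_smul]⟩
  · exact ⟨-1, by rw [h1, neg_one_smul]⟩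

lemma IsProjFan.continuous_toP2 (h : IsProjFan v Finset.univ T) : Continuous h.toP2 := by
  refine (locallyFinite_of_finite fun t : T =>
    {x : realization h.complex | (x : α → ℝ) ∈ closedSimplex (base (t : Finset _))}).continuous
    ?_ ?_ ?_
  · rw [Set.eq_univ_iff_forall]
    intro x
    obtain ⟨t, ht, hx⟩ := h.exists_mem_closedSimplex x
    exact Set.mem_iUnion.2 ⟨⟨t, ht⟩, hx⟩
  · exact fun t => (isCompact_closedSimplex _).isClosed.preimage continuous_subtype_val
  · rintro ⟨t, ht⟩
    rw [continuousOn_iff_continuous_domRestrict]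
    have : Set.domRestrict _ h.toP2 = fun x : {x : realization h.complex |
        (x : α → ℝ) ∈ closedSimplex (base t)} => Projectivization.mk' ℝ
          (⟨chart v t x.1.1, h.chart_ne_zero ht x.2⟩ : {w : E3 // w ≠ 0}) := by
      funext x
      exact h.toP2_eq ht x.1 x.2
    rw [this]
    exact continuous_mk'.comp (Continuous.subtype_mk ((continuous_chart v t).comp
      (continuous_subtype_val.comp continuous_subtype_val)) _)

lemma IsProjFan.bijective_toP2 (h : IsProjFan v Finset.univ T) : Function.Bijective h.toP2 := by
  constructor
  · intro x y hxy
    obtain ⟨s, hs, hxs⟩ := h.exists_mem_closedSimplex x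
    obtain ⟨t, ht, hyt⟩ := h.exists_mem_closedSimplex y
    rw [h.toP2_eq hs x hxs, h.toP2_eq ht y hyt, Projectivization.mk_eq_mk_iff'] at hxy
    obtain ⟨r, hr⟩ := hxy
    exact Subtype.ext (h.eq_of_chart_eq_smul hs ht hxs hyt hr.symm)
  · intro a
    induction a using Projectivization.ind with | h w hw =>
    obtain ⟨t, ht, x, hx, r, hr⟩ := h.exists_chart_eq_smul hw
    have hxr : x ∈ realization h.complex :=
      Set.mem_biUnion (h.base_mem_faces ht) hx
    refine ⟨⟨x, hxr⟩, ?_⟩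
    rw [h.toP2_eq ht ⟨x, hxr⟩ hx, Projectivization.mk_eq_mk_iff']
    exact ⟨r, hr.symm⟩

/-- The realization is compact and the projective plane is Hausdorff. -/
noncomputable def IsProjFan.homeo (h : IsProjFan v Finset.univ T) : realization h.complex ≃ₜ P2 :=
  haveI : CompactSpace (realization h.complex) := isCompact_iff_compactSpace.1
    ((Set.toFinite h.complex.faces).isCompact_biUnion fun s _ => isCompact_closedSimplex s)
  Continuous.homeoOfEquivCompactToT2 (f := Equiv.ofBijective h.toP2 h.bijective_toP2)
    h.continuous_toP2

end Chart

theorem IsProjFan.geodesic {P : Finset P2} [DecidableEq P] {v : P → S2} (hv : ∀ a, proj (v a) = a)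
    {T : Finset (Finset (P × Bool))} (h : IsProjFan (fun a => (v a : E3)) Finset.univ T)
    {s : Finset P} (hs : s ∈ h.complex.faces) :
    IsGeodesicSimplex s (h.homeo '' {x | (x : P → ℝ) ∈ closedSimplex s}) := by
  obtain ⟨hne, t, ht, hst⟩ := id hs
  choose ℓ hℓ hℓ' using fun a : s => exists_mem_of_mem_base (hst a.2)
  have hunit : ∀ i : P × Bool, ∃ y : S2, (y : E3) = signed (fun a => (v a : E3)) i ∧
      proj y = i.1 := by
    rintro ⟨a, _ | _⟩
    · refine ⟨-v a, by simp [signed], ?_⟩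
      rw [← hv a, proj, proj, Projectivization.mk_eq_mk_iff']
      exact ⟨-1, by simp⟩
    · exact ⟨v a, rfl, hv a⟩
  choose lift hlift hproj using hunit
  refine ⟨fun a => lift (ℓ a), fun a => by rw [hproj, hℓ'], ?_, ?_⟩
  · simp only [hlift]
    exact (h.fan.linearIndependent ht).comp (fun a => (⟨ℓ a, hℓ a⟩ : t)) fun a b hab =>
      Subtype.ext (by
        have hab' : ℓ a = ℓ b := congrArg Subtype.val hab
        rw [← hℓ' a, ← hℓ' b, hab'])
  · have hsum : ∀ x : P → ℝ, (∀ a, a ∉ s → x a = 0) → chart (fun a => (v a : E3)) t x =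
        ∑ a : s, x a • (lift (ℓ a) : E3) := by
      intro x hx
      simp only [hlift]
      exact h.chart_eq_sum ht hℓ hℓ' hx
    ext a
    constructor
    · rintro ⟨x, hx, rfl⟩
      have hxt := closedSimplex_mono hst hx
      obtain ⟨y, hy, hya⟩ := exists_proj_eq_mk (h.chart_ne_zero ht hxt)
      refine ⟨y, ⟨fun a => ‖chart (fun a => (v a : E3)) t x‖⁻¹ * (x : P → ℝ) a, fun a =>
        mul_nonneg (inv_nonneg.2 (norm_nonneg _)) (hx.1.1 _), ?_⟩, hya.trans (h.toP2_eq ht x hxt).symm⟩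
      rw [hy]
      simp only [mul_smul]
      rw [← Finset.smul_sum, ← hsum x hx.2]
    · rintro ⟨y, ⟨c, hc, hy⟩, rfl⟩
      have hpos : 0 < ∑ a, c a := by
        refine (Finset.sum_nonneg fun i _ => hc i).lt_of_ne' fun h0 =>
          ne_zero_of_mem_unit_sphere y ?_
        rw [Finset.sum_eq_zero_iff_of_nonneg fun i _ => hc i] at h0
        rw [hy]
        exact Finset.sum_eq_zero fun i hi => by rw [h0 i hi, zero_smul]
      set x : P → ℝ := fun a => if ha : a ∈ s then (∑ a, c a)⁻¹ * c ⟨a, ha⟩ else 0 with hxdef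
      have hxs : ∀ a : s, x a = (∑ a, c a)⁻¹ * c a := fun a => by simp [hxdef]
      have hx0 : ∀ a, a ∉ s → x a = 0 := fun a ha => by simp [hxdef, ha]
      have hx : x ∈ closedSimplex s := by
        refine ⟨⟨fun a => ?_, ?_⟩, hx0⟩
        · by_cases ha : a ∈ s
          · rw [hxs ⟨a, ha⟩]
            exact mul_nonneg (inv_nonneg.2 hpos.le) (hc _)
          · rw [hx0 a ha]
        · rw [← Finset.sum_subset (Finset.subset_univ s) fun a _ ha => hx0 a ha,
            ← Finset.sum_coe_sort s]
          simp only [hxs]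
          rw [← Finset.mul_sum, inv_mul_cancel₀ hpos.ne']
      have hxr : x ∈ realization h.complex := Set.mem_biUnion hs hx
      refine ⟨⟨x, hxr⟩, hx, ?_⟩
      refine (h.toP2_eq ht ⟨x, hxr⟩ (closedSimplex_mono hst hx)).trans ?_
      rw [proj, Projectivization.mk_eq_mk_iff']
      refine ⟨(∑ a, c a)⁻¹, ?_⟩
      rw [hsum x hx0, hy, Finset.smul_sum]
      simp only [hxs, mul_smul]

/-- The triangulation of the projective plane that is the quotient of a projective fan on
representatives of the points of `P`. -/
noncomputable def IsProjFan.triangulation {P : Finset P2} [DecidableEq P] {v : P → S2}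
    (hv : ∀ a, proj (v a) = a)
    {T : Finset (Finset (P × Bool))} (h : IsProjFan (fun a => (v a : E3)) Finset.univ T) :
    ProjectiveTriangulation P where
  complex := h.complex
  pure_two := by
    rintro s ⟨-, t, ht, hst⟩
    exact ⟨base t, h.base_mem_faces ht, hst, h.card_base ht⟩
  homeo := h.homeo
  geodesic _ hs := h.geodesic hv hs

lemma ne_smul_of_proj_ne {x y : S2} (h : proj x ≠ proj y) (r : ℝ) : (x : E3) ≠ r • (y : E3) := by
  intro hxy
  apply h
  rw [proj, proj, Projectivization.mk_eq_mk_iff']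
  exact ⟨r, hxy.symm⟩

end ProjTri

theorem mainTheorem1 (P : Finset ProjTri.P2)
    (hP : ∃ S : Finset ProjTri.P2, S ⊆ P ∧ 6 ≤ S.card ∧ ProjTri.InGeneralPosition S) :
    Nonempty (ProjTri.ProjectiveTriangulation P) := by
  classical
  obtain ⟨S, hSP, hS6, hS⟩ := hP
  choose v hv using fun a : P => ProjTri.exists_proj_eq (a : ProjTri.P2)
  obtain ⟨R, hRS, hR6⟩ := Finset.exists_subset_card_eq hS6
  let e : Fin 6 ≃ R := (R.equivFinOfCardEq hR6).symm
  let f : Fin 6 ↪ P := ⟨fun i => ⟨e i, hSP (hRS (e i).2)⟩, fun i j hij =>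
    e.injective (Subtype.ext (congrArg (fun a : P => (a : ProjTri.P2)) hij))⟩
  have hf : ∀ i, ((f i : P) : ProjTri.P2) ∈ S := fun i => hRS (e i).2
  have hgen : ProjTri.IsGeneric fun i => (v (f i) : ProjTri.E3) := by
    intro i j k hij hjk hik
    refine ProjTri.tdet_ne_zero_of_not_isCollinear ?_
    rw [hv, hv, hv]
    have hne : ∀ {i j}, i ≠ j → ((f i : P) : ProjTri.P2) ≠ f j := fun h hh =>
      h (f.injective (Subtype.ext hh))
    exact hS _ (hf i) _ (hf j) _ (hf k) (hne hij) (hne hjk) (hne hik)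
  obtain ⟨T, hT⟩ := ProjTri.hasProjFan_of_isGeneric hgen
  have h6 := ProjTri.IsProjFan.map f (fun _ => true) (v := fun a => (v a : ProjTri.E3)) hT
  have hall : ∀ U : Finset P, ∃ T, ProjTri.IsProjFan (fun a => (v a : ProjTri.E3))
      (U ∪ Finset.univ.map f) T := by
    intro U
    induction U using Finset.induction_on with
    | empty => exact ⟨_, by rw [Finset.empty_union]; exact h6⟩
    | insert a U _ ih =>
      obtain ⟨T, hT⟩ := ih
      rw [Finset.insert_union]
      by_cases ha : a ∈ U ∪ Finset.univ.map f
      · exact ⟨T, by rwa [Finset.insert_eq_of_mem ha]⟩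
      · refine hT.insert ha (ne_zero_of_mem_unit_sphere (v a)) fun b hb r => ?_
        refine ProjTri.ne_smul_of_proj_ne ?_ r
        rw [hv, hv]
        exact fun hab => ha (by rwa [Subtype.ext hab])
  obtain ⟨T, hT⟩ := hall Finset.univ
  rw [Finset.union_eq_left.2 (Finset.subset_univ _)] at hT
  exact ⟨hT.triangulation hv⟩
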